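/- For $n\ge 1$ let $G_n=(V_n,E_n)$ be a connected finite simple graph with $n$ vertices, and let $\vec E_n$ be its set of oriented edges (each edge in both orientations). Let $\mathscr P$ be a Poisson point process on $\vec E_n\times[0,\infty)$ with intensity (counting measure) $\otimes$ (Lebesgue measure). Given initial opinions $\eta_0\in\{0,1\}^{V_n}$, the voter model $(\eta_t)_{t\ge0}$ driven by $\mathscr P$ evolves as follows: whenever $(u,v)$ has a tick at time $t$, the vertex $v$ copies the opinion that $u$ has just before time $t$, and opinions do not change otherwise. Let $f_n(\eta_0,\mathscr P)\in\{0,1\}$ be the consensus opinion, i.e. the common opinion of all vertices at all large times. Fix $p\in(0,1)$ and let $\eta_0$ have i.i.d. Bernoulli$(p)$ entries, independent of $\mathscr P$. For $\epsilon\in[0,1]$, - $\eta_0^\epsilon$ is obtained from $\eta_0$ by replacing each entry, independently with probability $\epsilon$, by a fresh independent Bernoulli$(p)$ variable (everything independent of $\mathscr P$); - $\mathscr P^\epsilon=\mathscr P'\cup\mathscr P(\epsilon)$, where $\mathscr P'$ is obtained from $\mathscr P$ by deleting each tick independently with probability $\epsilon$, and $\mathscr P(\epsilon)$ is an independent Poisson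 point process on $\vec E_n\times[0,\infty)$ with $\epsilon$ times the intensity of $\mathscr P$ (everything independent of $\eta_0$). Then, almost surely, the consensus opinions $f_n(\eta_0,\mathscr P)$, $f_n(\eta_0^\epsilon,\mathscr P)$ and $f_n(\eta_0,\mathscr P^\epsilon)$ exist and are uniquely determined, and the following hold. 1. (Noise stability with respect to the initial opinions.) For all $n\ge1$ and $\epsilon\in[0,1]$, $$\mathbb P\big[f_n(\eta_0,\mathscr P)\ne f_n(\eta_0^\epsilon,\mathscr P)\big]\le\epsilon ;$$ in particular $\lim_{\epsilon\to0}\sup_{n\ge1}\mathbb P\big[f_n(\eta_0,\mathscr P)\ne f_n(\eta_0^\epsilon,\mathscr P)\big]=0$. 2. (Noise sensitivity with respect to the clock ticks.) For every $\epsilon\in(0,1]$, $$\lim_{n\to\infty}\Big(\mathbb E\big[f_n(\eta_0,\mathscr P)f_n(\eta_0,\mathscr P^\epsilon)\big]-\mathbb E\big[f_n(\eta_0,\mathscr P)\big]^2\Big)=0 .$$ 3. Let $(\epsilon_n)$ be any sequence in $[0,1]$ and let $c_n=\operatorname{Cov}\big(f_n(\eta_0,\mathscr P),f_n(\eta_0,\mathscr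 P^{\epsilon_n})\big)$. For all $n\ge1$, $$c_n=\frac{p-p^2}{1+(n-1)\epsilon_n}.$$ Moreover, $c_n\to0$ if and only if $n\epsilon_n\to\infty$; in particular $\limsup_n c_n=0$ if $n\epsilon_n\to\infty$. If $(n\epsilon_n)$ is bounded, then $\limsup_n c_n>0$, and there is even $c>0$ with $c_n\ge c$ for all $n\ge1$. -/

import Mathlib

open MeasureTheory ProbabilityTheory Filter Topology Set
open scoped NNReal ENNReal

namespace Voter

universe u v w

/-- Oriented edges carry the discrete σ-algebra. -/
instance dartMeasurableSpace {V : Type u} (G : SimpleGraph V) : MeasurableSpace G.Dart := ⊤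

section PointProcess

/-- The σ-algebra on configurations of points of `X` generated by the numbers of points in
measurable sets. -/
noncomputable abbrev configSigma (X : Type u) [MeasurableSpace X] : MeasurableSpace (Set X) :=
  ⨆ A : {A : Set X // MeasurableSet A},
    MeasurableSpace.comap (fun N : Set X => (N ∩ A.1).encard) inferInstance

/-- The random set of points `N` is a Poisson point process with intensity measure `ν`. -/
structure IsPoissonPointProcess {X : Type u} [MeasurableSpace X] {Ω : Type w} [MeasurableSpace Ω]
    (ν : Measure X) (N : Ω → Set X) (μ : Measure Ω) : Prop where
  measurable_count : ∀ A : Set X, MeasurableSet A → Measurable fun ω => (N ω ∩ A).encard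
  count_law : ∀ A : Set X, MeasurableSet A → ν A ≠ ∞ → ∀ k : ℕ,
    μ {ω | (N ω ∩ A).encard = (k : ℕ∞)} = poissonMeasure (ν A).toNNReal {k}
  count_indep : ∀ (m : ℕ) (A : Fin m → Set X), (∀ i, MeasurableSet (A i)) →
    Pairwise (fun i j => Disjoint (A i) (A j)) →
    iIndepFun (fun i ω => (N ω ∩ A i).encard) μ

/-- `X` is a family of i.i.d. Bernoulli(`p`) variables (`true` with probability `p`). -/
structure IsBernoulliFamily {ι : Type u} {Ω : Type w} [MeasurableSpace Ω]
    (p : ℝ) (X : ι → Ω → Bool) (μ : Measure Ω) : Prop where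
  measurable : ∀ i, Measurable (X i)
  law : ∀ i, μ {ω | X i ω = true} = ENNReal.ofReal p
  indep : iIndepFun X μ

/-- The σ-algebra generated by a family of Boolean variables. -/
abbrev sigmaOf {ι : Type u} {Ω : Type w} (X : ι → Ω → Bool) : MeasurableSpace Ω :=
  MeasurableSpace.comap (fun ω i => X i ω) MeasurableSpace.pi

/-- The σ-algebra generated by a random configuration of points. -/
noncomputable abbrev sigmaOfConfig {X : Type u} [MeasurableSpace X] {Ω : Type w} (N : Ω → Set X) :
    MeasurableSpace Ω :=
  MeasurableSpace.comap N (configSigma X)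

end PointProcess

section Dynamics

variable {V : Type u} {G : SimpleGraph V} {S : Type v}

/-- A collection of clock ticks: `(e, t)` belongs to it when the clock of the oriented edge `e`
ticks at time `t`. -/
abbrev Ticks (G : SimpleGraph V) : Type u := Set (G.Dart × ℝ≥0)

/-- Counting measure on oriented edges times Lebesgue measure on `[0, ∞)`, times `r`. -/
noncomputable def clockIntensity (G : SimpleGraph V) (r : ℝ) : Measure (G.Dart × ℝ≥0) :=
  ENNReal.ofReal r • (Measure.count : Measure G.Dart).prod
    (Measure.comap ((↑) : ℝ≥0 → ℝ) volume)

/-- `η` is the trajectory of the voter model started from `η₀` and driven by the ticks `P`: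
when `(u, v)` ticks at time `t`, `v` copies the opinion that `u` has just before `t`, and `v`
keeps its opinion during any period in which no clock pointing to `v` ticks. -/
structure IsVoterPath (P : Ticks G) (η₀ : V → S) (η : ℝ≥0 → V → S) : Prop where
  init : η 0 = η₀
  copy : ∀ (e : G.Dart) (t : ℝ≥0), 0 < t → (e, t) ∈ P →
    ∀ᶠ s in 𝓝[<] t, η t e.snd = η s e.fst
  keep : ∀ (v : V) (s t : ℝ≥0), s ≤ t →
    (∀ (e : G.Dart) (r : ℝ≥0), (e, r) ∈ P → e.snd = v → r ∉ Ioc s t) → η t v = η s v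

/-- The voter model started from `η₀` and driven by `P` is eventually constant equal to `x`. -/
def IsConsensus (P : Ticks G) (η₀ : V → S) (x : S) : Prop :=
  ∃ η : ℝ≥0 → V → S, IsVoterPath P η₀ η ∧ ∀ᶠ t in atTop, ∀ v, η t v = x

/-- The consensus opinion `f(η₀, P)` (an arbitrary value if there is no consensus). -/
noncomputable def consensus [Nonempty S] (P : Ticks G) (η₀ : V → S) : S :=
  Classical.epsilon (IsConsensus P η₀)

/-- The number of earlier ticks of the same clock. -/
noncomputable def tickIndex (P : Ticks G) (x : G.Dart × ℝ≥0) : ℕ :=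
  {s : ℝ≥0 | (x.1, s) ∈ P ∧ s < x.2}.ncard

/-- The ticks that are left when the `k`-th tick of the clock of `e` (counting from `0`) is
deleted whenever `del (e, k) = true`. -/
def thinning (P : Ticks G) (del : G.Dart × ℕ → Bool) : Ticks G :=
  {x | x ∈ P ∧ del (x.1, tickIndex P x) = false}

/-- The opinions `0`, `1` as real numbers. -/
def opinionValue (b : Bool) : ℝ := if b then 1 else 0

end Dynamics

/-- A realization of the voter model on `G` with i.i.d. Bernoulli(`p`) initial opinions and
rate-one clocks, together with an `ε`-resampling of the initial opinions. -/
structure InitialNoiseModel {V : Type u} (G : SimpleGraph V) (p ε : ℝ) where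
  /-- the probability space -/
  Ω : Type w
  [mΩ : MeasurableSpace Ω]
  /-- the probability measure -/
  μ : Measure Ω
  [isProb : IsProbabilityMeasure μ]
  /-- the initial opinions -/
  opinion : V → Ω → Bool
  /-- which opinions are resampled -/
  resample : V → Ω → Bool
  /-- the fresh opinions -/
  fresh : V → Ω → Bool
  /-- the clock ticks -/
  clock : Ω → Ticks G
  opinion_law : IsBernoulliFamily p opinion μ
  resample_law : IsBernoulliFamily ε resample μ
  fresh_law : IsBernoulliFamily p fresh μ
  clock_law : IsPoissonPointProcess (clockIntensity G 1) clock μ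
  indep : iIndep ![sigmaOf opinion, sigmaOf resample, sigmaOf fresh, sigmaOfConfig clock] μ

attribute [instance] InitialNoiseModel.mΩ InitialNoiseModel.isProb

namespace InitialNoiseModel

variable {V : Type u} {G : SimpleGraph V} {p ε : ℝ} (M : InitialNoiseModel.{u, w} G p ε)

/-- The initial configuration. -/
def init (ω : M.Ω) : V → Bool := fun v => M.opinion v ω

/-- The `ε`-perturbed initial configuration. -/
def noisyInit (ω : M.Ω) : V → Bool :=
  fun v => if M.resample v ω then M.fresh v ω else M.opinion v ω

/-- `f(η₀, P)` -/
noncomputable def f (ω : M.Ω) : Bool := consensus (M.clock ω) (M.init ω)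

/-- `f(η₀^ε, P)` -/
noncomputable def fNoisy (ω : M.Ω) : Bool := consensus (M.clock ω) (M.noisyInit ω)

end InitialNoiseModel

/-- A realization of the voter model on `G` with i.i.d. Bernoulli(`p`) initial opinions and
rate-one clocks, together with an `ε`-perturbation of the clock ticks. -/
structure ClockNoiseModel {V : Type u} (G : SimpleGraph V) (p ε : ℝ) where
  /-- the probability space -/
  Ω : Type w
  [mΩ : MeasurableSpace Ω]
  /-- the probability measure -/
  μ : Measure Ω
  [isProb : IsProbabilityMeasure μ]
  /-- the initial opinions -/
  opinion : V → Ω → Bool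
  /-- the clock ticks -/
  clock : Ω → Ticks G
  /-- which ticks are deleted -/
  del : G.Dart × ℕ → Ω → Bool
  /-- the additional ticks -/
  extra : Ω → Ticks G
  opinion_law : IsBernoulliFamily p opinion μ
  clock_law : IsPoissonPointProcess (clockIntensity G 1) clock μ
  del_law : IsBernoulliFamily ε del μ
  extra_law : IsPoissonPointProcess (clockIntensity G ε) extra μ
  indep : iIndep ![sigmaOf opinion, sigmaOfConfig clock, sigmaOf del, sigmaOfConfig extra] μ

attribute [instance] ClockNoiseModel.mΩ ClockNoiseModel.isProb

namespace ClockNoiseModel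

variable {V : Type u} {G : SimpleGraph V} {p ε : ℝ} (M : ClockNoiseModel.{u, w} G p ε)

/-- The initial configuration. -/
def init (ω : M.Ω) : V → Bool := fun v => M.opinion v ω

/-- The `ε`-perturbed clock ticks: an `ε`-thinning of the ticks and the additional ticks. -/
def noisyClock (ω : M.Ω) : Ticks G :=
  thinning (M.clock ω) (fun x => M.del x ω) ∪ M.extra ω

/-- `f(η₀, P)`, as a real number -/
noncomputable def f (ω : M.Ω) : ℝ := opinionValue (consensus (M.clock ω) (M.init ω))

/-- `f(η₀, P^ε)`, as a real number -/
noncomputable def fNoisy (ω : M.Ω) : ℝ := opinionValue (consensus (M.noisyClock ω) (M.init ω))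

end ClockNoiseModel

end Voter

/-! Start the model from pairwise distinct opinions, `η₀ = id`. Almost surely it reaches consensus
on the label of one vertex, the ancestor `a`, which depends on the ticks alone. Copying commutes
with relabelling opinions, so the consensus opinion from any `η₀` is `η₀ a`
(`IsRegular.consensus_eq`). Resampling initial opinions can therefore matter only if the entry at
`a` is resampled, and since `a` is independent of the resampling marks this has probability `ε`.

For noise in the clocks let `a` and `b` be the ancestors under `P` and `P^ε`. The opinions are
independent of the ticks, so the covariance is `(p - p²) ℙ(a = b)`, and it remains to see that `ℙ(a
= b) = 1 / (1 + (n - 1) ε)`. Run the two models together from distinct opinions. Count each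
agreement between the profiles at the same vertex with weight `1`, and each agreement between
different vertices with weight `ε`; this is `overlap`. A clock moves the first profile alone at rate
`ε`, both at rate `1 - ε`, and the second alone at rate `ε`. The mean changes due to a dart and its
reversal cancel (`sum_kernelWeight_copyMap`), so the expected overlap is constant on every graph. It
starts at `n` and ends at `n (1 + (n - 1) ε)` or `0` according as `a = b` or not, which gives the
formula.

The computation is carried out in discrete time. Cut `[0, k]` into cells of length `2⁻ᵏ` and ignore
every cell that does not contain exactly one tick. The resulting `chain` preserves the expected
overlap exactly for every `k` (`IsTickFamily.integral_overlap`). By Borel–Cantelli, almost surely no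
cell holds two ticks once `k` is large; then `chain` follows the true trajectories (`chain_eq`), and
dominated convergence gives the limit (`tendsto_integral_ancestors_eq`). Consensus is almost sure
because a finite list of ticks spreading one opinion everywhere occurs in some block of unit
intervals. -/

namespace Voter

universe u v w

/-! ### Trajectories driven by a regular configuration of ticks -/

section Paths

variable {V : Type u} {G : SimpleGraph V} {S : Type v}

open Classical in
/-- The effect of a tick of `e` on opinions, by precomposition: the head of `e` is sent to its
tail. -/
noncomputable def copyMap (e : G.Dart) : V → V := Function.update id e.snd e.fst

lemma copyMap_snd (e : G.Dart) : copyMap e e.snd = e.fst := by simp [copyMap]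

lemma copyMap_of_ne (e : G.Dart) {v : V} (h : v ≠ e.snd) : copyMap e v = v := by
  classical
  rw [copyMap, Function.update_of_ne h, id]

/-- The points whose time lies in `(s, t]`. -/
def window (G : SimpleGraph V) (s t : ℝ≥0) : Set (G.Dart × ℝ≥0) := {x | x.2 ∈ Ioc s t}

lemma mem_window {s t : ℝ≥0} {x : G.Dart × ℝ≥0} : x ∈ window G s t ↔ s < x.2 ∧ x.2 ≤ t := Iff.rfl

/-- Locally finitely many ticks at positive times, no two of them simultaneous. -/
structure IsRegular (P : Ticks G) : Prop where
  finite : ∀ t, (P ∩ window G 0 t).Finite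
  inj : ∀ x ∈ P, ∀ y ∈ P, 0 < x.2 → x.2 = y.2 → x = y

lemma IsVoterPath.eq_of_empty {P : Ticks G} {η₀ : V → S} {η : ℝ≥0 → V → S}
    (h : IsVoterPath P η₀ η) {s t : ℝ≥0} (hst : s ≤ t) (hP : P ∩ window G s t = ∅) :
    η t = η s := by
  funext v
  refine h.keep v s t hst fun e r he _ hr => ?_
  have : (e, r) ∈ P ∩ window G s t := ⟨he, hr⟩
  simp [hP] at this

lemma nhdsLT_neBot_of_pos {r : ℝ≥0} (hr : 0 < r) : (𝓝[<] r).NeBot :=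
  nhdsLT_neBot_of_exists_lt ⟨0, hr⟩

/-- Nothing changes before or after the only tick `r`. The value just before `r` in `copy` can thus
be read at some `s'` in `(s, r)` and carried back to `s`. -/
lemma IsVoterPath.eq_of_singleton {P : Ticks G} {η₀ : V → S} {η : ℝ≥0 → V → S}
    (h : IsVoterPath P η₀ η) {s t r : ℝ≥0} {e : G.Dart} (hP : P ∩ window G s t = {(e, r)}) :
    η t = η s ∘ copyMap e := by
  have hmem : (e, r) ∈ P ∩ window G s t := by simp [hP]
  have huniq : ∀ x ∈ P, s < x.2 → x.2 ≤ t → x = (e, r) := fun x hx h1 h2 => by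
    have : x ∈ P ∩ window G s t := ⟨hx, h1, h2⟩
    simpa [hP] using this
  have hsr : s < r := hmem.2.1
  have hrt : r ≤ t := hmem.2.2
  have hr0 : 0 < r := lt_of_le_of_lt zero_le hsr
  funext v
  by_cases hv : v = e.snd
  · subst hv
    simp only [Function.comp_apply, copyMap_snd]
    have h1 : η t e.snd = η r e.snd := by
      refine h.keep _ r t hrt fun e' r' he' _ hr' => ?_
      have := huniq _ he' (hsr.trans hr'.1) hr'.2
      simp only [Prod.mk.injEq] at this
      exact absurd this.2 hr'.1.ne'
    have := nhdsLT_neBot_of_pos hr0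
    obtain ⟨s', hs', hss', hs'r⟩ := ((h.copy e r hr0 hmem.1).and
      ((eventually_nhdsWithin_of_eventually_nhds (eventually_gt_nhds hsr)).and
        self_mem_nhdsWithin)).exists
    rw [h1, hs']
    refine h.keep _ s s' hss'.le fun e' r' he' _ hr' => ?_
    have hlt : r' < r := lt_of_le_of_lt hr'.2 hs'r
    have := huniq _ he' hr'.1 (hlt.le.trans hrt)
    simp only [Prod.mk.injEq] at this
    exact hlt.ne this.2
  · simp only [Function.comp_apply, copyMap_of_ne e hv]
    refine h.keep _ s t (hsr.le.trans hrt) fun e' r' he' hv' hr' => ?_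
    have := huniq _ he' hr'.1 hr'.2
    simp only [Prod.mk.injEq] at this
    exact hv (hv' ▸ this.1 ▸ rfl)

lemma IsRegular.mono {P Q : Ticks G} (h : IsRegular Q) (hPQ : P ⊆ Q) : IsRegular P where
  finite t := (h.finite t).subset (inter_subset_inter_left _ hPQ)
  inj x hx y hy := h.inj x (hPQ hx) y (hPQ hy)

lemma IsRegular.finite_window {P : Ticks G} (h : IsRegular P) (s t : ℝ≥0) :
    (P ∩ window G s t).Finite :=
  (h.finite t).subset fun _ hx => ⟨hx.1, lt_of_le_of_lt zero_le hx.2.1, hx.2.2⟩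

/-- The opinions at time `t` are read off from those at time `s` through a map that only depends
on the ticks during `(s, t]`. -/
lemma IsRegular.exists_flow {P : Ticks G} (hP : IsRegular P) (s t : ℝ≥0) (hst : s ≤ t) :
    ∃ φ : V → V, ∀ (Q : Ticks G) (η₀ : V → S) (η : ℝ≥0 → V → S),
      Q ∩ window G s t = P ∩ window G s t → IsVoterPath Q η₀ η → η t = η s ∘ φ := by
  induction hn : (P ∩ window G s t).ncard using Nat.strong_induction_on generalizing t with
  | _ n ih =>
  rcases (P ∩ window G s t).eq_empty_or_nonempty with he | hne
  · exact ⟨id, fun Q η₀ η hQ hη => hη.eq_of_empty hst (hQ.trans he)⟩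
  have hfin := hP.finite_window s t
  -- Peel off the last tick `r` of the window: cut at a time `s'` before `r` and not before any
  -- other tick, and use induction on the number of ticks up to `s'`.
  obtain ⟨⟨e, r⟩, hx, hmax⟩ := hfin.exists_maximalFor Prod.snd _ hne
  have hmax' : ∀ y ∈ P ∩ window G s t, y.2 ≤ r := fun y hy => by
    rcases le_total y.2 r with h | h
    · exact h
    · exact hmax hy h
  have hsr : s < r := hx.2.1
  have hr0 : 0 < r := lt_of_le_of_lt zero_le hsr
  have := nhdsLT_neBot_of_pos hr0
  have hev : ∀ᶠ s' in 𝓝[<] r, ∀ y ∈ P ∩ window G s t, y.2 < r → y.2 ≤ s' := by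
    rw [eventually_all_finite hfin]
    intro y _
    by_cases hy : y.2 < r
    · filter_upwards [eventually_nhdsWithin_of_eventually_nhds (eventually_gt_nhds hy)]
        with a ha _ using ha.le
    · exact Eventually.of_forall fun _ h => absurd h hy
  obtain ⟨s', hs', hss', hs'r⟩ := (hev.and
      ((eventually_nhdsWithin_of_eventually_nhds (eventually_gt_nhds hsr)).and
        self_mem_nhdsWithin)).exists
  replace hs'r : s' < r := hs'r
  have hsub : P ∩ window G s s' ⊆ P ∩ window G s t :=
    fun y hy => ⟨hy.1, hy.2.1, hy.2.2.trans (hs'r.le.trans hx.2.2)⟩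
  have hlt : (P ∩ window G s s').ncard < n := by
    rw [← hn]
    refine ncard_lt_ncard ⟨hsub, fun hcon => ?_⟩ hfin
    exact absurd (hcon hx).2.2 (not_le.2 hs'r)
  obtain ⟨φ, hφ⟩ := ih _ hlt s' hss'.le rfl
  refine ⟨φ ∘ copyMap e, fun Q η₀ η hQ hη => ?_⟩
  have hrestr : ∀ a b, s ≤ a → b ≤ t → Q ∩ window G a b = P ∩ window G a b := by
    intro a b ha hb
    ext y
    have := Set.ext_iff.1 hQ y
    simp only [mem_inter_iff, mem_window] at this ⊢
    constructor
    · rintro ⟨h1, h2, h3⟩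
      exact ⟨(this.1 ⟨h1, lt_of_le_of_lt ha h2, h3.trans hb⟩).1, h2, h3⟩
    · rintro ⟨h1, h2, h3⟩
      exact ⟨(this.2 ⟨h1, lt_of_le_of_lt ha h2, h3.trans hb⟩).1, h2, h3⟩
  have h1 := hφ Q η₀ η (hrestr _ _ le_rfl (hs'r.le.trans hx.2.2)) hη
  have h2 : Q ∩ window G s' t = {(e, r)} := by
    rw [hrestr _ _ hss'.le le_rfl]
    ext y
    simp only [mem_singleton_iff]
    constructor
    · intro hy
      have hyw : y ∈ P ∩ window G s t := ⟨hy.1, hss'.trans hy.2.1, hy.2.2⟩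
      refine hP.inj y hy.1 _ hx.1 (lt_of_le_of_lt zero_le hy.2.1) ?_
      refine le_antisymm (hmax' y hyw) (not_lt.1 fun hlt => ?_)
      exact absurd (hs' y hyw hlt) (not_le.2 hy.2.1)
    · rintro rfl
      exact ⟨hx.1, hs'r, hx.2.2⟩
  rw [hη.eq_of_singleton h2, h1, Function.comp_assoc]

/-- Two trajectories with the same start and the same ticks up to time `t` agree at time `t`. -/
lemma IsRegular.path_unique {P Q Q' : Ticks G} (hP : IsRegular P) {η₀ : V → S}
    {η η' : ℝ≥0 → V → S} (hη : IsVoterPath Q η₀ η) (hη' : IsVoterPath Q' η₀ η') {t : ℝ≥0}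
    (hQ : Q ∩ window G 0 t = P ∩ window G 0 t) (hQ' : Q' ∩ window G 0 t = P ∩ window G 0 t) :
    η t = η' t := by
  obtain ⟨φ, hφ⟩ := hP.exists_flow (S := S) 0 t zero_le
  rw [hφ Q η₀ η hQ hη, hφ Q' η₀ η' hQ' hη', hη.init, hη'.init]

lemma isVoterPath_empty (η₀ : V → S) : IsVoterPath (∅ : Ticks G) η₀ fun _ => η₀ :=
  ⟨rfl, fun _ _ _ h => absurd h (notMem_empty _), fun _ _ _ _ _ => rfl⟩

/-- The new tick comes after all others, so the old path is followed before `r` and frozen from `r`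
on. Finiteness of `P` leaves a gap before `r` in which the old path already has its value at `r`. -/
lemma IsVoterPath.insert {P : Ticks G} {η₀ : V → S} {η : ℝ≥0 → V → S} (hη : IsVoterPath P η₀ η)
    {e : G.Dart} {r : ℝ≥0} (hr : 0 < r) (hP : ∀ x ∈ P, x.2 < r) (hfin : P.Finite) :
    IsVoterPath (insert (e, r) P) η₀ fun t => if t < r then η t else η r ∘ copyMap e where
  init := by simp [hr, hη.init]
  copy e' t ht he' := by
    rcases mem_insert_iff.1 he' with h | h
    · obtain ⟨rfl, rfl⟩ := Prod.mk.inj h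
      have hev : ∀ᶠ s in 𝓝[<] t, ∀ y ∈ P, y.2 ≤ s := by
        rw [eventually_all_finite hfin]
        intro y hy
        filter_upwards [eventually_nhdsWithin_of_eventually_nhds (eventually_gt_nhds (hP y hy))]
          with a ha using ha.le
      filter_upwards [self_mem_nhdsWithin, hev] with s hs hs'
      simp only [lt_irrefl, if_false, Function.comp_apply, copyMap_snd, mem_Iio.1 hs, if_true]
      refine hη.keep _ s t (mem_Iio.1 hs).le fun e'' r'' he'' _ hr'' => ?_
      exact absurd (hs' _ he'') (not_le.2 hr''.1)
    · have htr : t < r := hP _ h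
      filter_upwards [hη.copy e' t ht h, self_mem_nhdsWithin] with s hs hst
      simp only [htr, if_true, (mem_Iio.1 hst).trans htr, hs]
  keep v s t hst hv := by
    by_cases ht : t < r
    · simp only [ht, if_true, lt_of_le_of_lt hst ht]
      exact hη.keep v s t hst fun e' r' he' => hv e' r' (mem_insert_of_mem _ he')
    · by_cases hs : s < r
      · simp only [ht, hs, if_true, if_false, Function.comp_apply]
        have hne : v ≠ e.snd := fun h =>
          hv e r (mem_insert _ _) h.symm ⟨hs, not_lt.1 ht⟩
        rw [copyMap_of_ne e hne]
        exact hη.keep v s r hs.le fun e' r' he' h hr' =>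
          hv e' r' (mem_insert_of_mem _ he') h ⟨hr'.1, hr'.2.trans (not_lt.1 ht)⟩
      · simp only [ht, hs, if_false]

lemma exists_path_of_finite (η₀ : V → S) (F : Finset (G.Dart × ℝ≥0))
    (hpos : ∀ x ∈ F, 0 < x.2) (hinj : ∀ x ∈ F, ∀ y ∈ F, x.2 = y.2 → x = y) :
    ∃ η, IsVoterPath (F : Ticks G) η₀ η := by
  classical
  revert hpos hinj
  refine Finset.induction_on_max_value (f := Prod.snd) F ?_ ?_
  · exact fun _ _ => ⟨_, by simpa using isVoterPath_empty η₀⟩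
  · intro x F hx hmax ih hpos hinj
    obtain ⟨η, hη⟩ := ih (fun y hy => hpos y (Finset.mem_insert_of_mem hy))
      fun y hy z hz => hinj y (Finset.mem_insert_of_mem hy) z (Finset.mem_insert_of_mem hz)
    have hlt : ∀ y ∈ F, y.2 < x.2 := fun y hy => by
      refine lt_of_le_of_ne (hmax y hy) fun h => hx ?_
      rw [← hinj y (Finset.mem_insert_of_mem hy) x (Finset.mem_insert_self _ _) h]
      exact hy
    rw [Finset.coe_insert]
    exact ⟨_, hη.insert (e := x.1) (r := x.2) (hpos x (Finset.mem_insert_self _ _)) hlt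
      F.finite_toSet⟩

/-- Up to each time `T` there are finitely many ticks. By uniqueness the paths for different `T` are
consistent, so the diagonal `t ↦ η t t` is a path for all of `P`. -/
lemma IsRegular.exists_path {P : Ticks G} (hP : IsRegular P) (η₀ : V → S) :
    ∃ η, IsVoterPath P η₀ η := by
  have key : ∀ T, ∃ η, IsVoterPath (P ∩ window G 0 T) η₀ η := fun T => by
    have := exists_path_of_finite η₀ (hP.finite T).toFinset
      (fun x hx => ((hP.finite T).mem_toFinset.1 hx).2.1)
      (fun x hx y hy => hP.inj x ((hP.finite T).mem_toFinset.1 hx).1 y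
        ((hP.finite T).mem_toFinset.1 hy).1 ((hP.finite T).mem_toFinset.1 hx).2.1)
    simpa using this
  choose η hη using key
  have hagree : ∀ s T, s ≤ T → η T s = η s s := fun s T hsT =>
    hP.path_unique (hη T) (hη s)
      (by ext x; simp only [mem_inter_iff, mem_window]; grind)
      (by ext x; simp only [mem_inter_iff, mem_window]; grind)
  refine ⟨fun t => η t t, (hη 0).init, fun e t ht he => ?_, fun v s t hst hv => ?_⟩
  · filter_upwards [(hη t).copy e t ht ⟨he, ht, le_rfl⟩, self_mem_nhdsWithin] with s hs hst
    rw [hs, hagree s t (mem_Iio.1 hst).le]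
  · rw [← hagree s t hst]
    exact (hη t).keep v s t hst fun e r he => hv e r he.1

/-- Copying commutes with relabelling. This carries results for distinct initial opinions over to
every initial configuration. -/
lemma IsVoterPath.comp {S' : Type w} {P : Ticks G} {η₀ : V → S} {η : ℝ≥0 → V → S}
    (hη : IsVoterPath P η₀ η) (g : S → S') : IsVoterPath P (g ∘ η₀) fun t => g ∘ η t where
  init := by rw [hη.init]
  copy e t ht he := (hη.copy e t ht he).mono fun s hs => by simp [hs]
  keep v s t hst h := by simp [hη.keep v s t hst h]

lemma IsConsensus.comp {S' : Type w} {P : Ticks G} {η₀ : V → S} {x : S}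
    (h : IsConsensus P η₀ x) (g : S → S') : IsConsensus P (g ∘ η₀) (g x) := by
  obtain ⟨η, hη, hx⟩ := h
  exact ⟨_, hη.comp g, hx.mono fun t ht v => by simp [ht v]⟩

lemma IsRegular.consensus_unique [Nonempty V] {P : Ticks G} (hP : IsRegular P) {η₀ : V → S}
    {x y : S} (hx : IsConsensus P η₀ x) (hy : IsConsensus P η₀ y) : x = y := by
  obtain ⟨η, hη, hx⟩ := hx
  obtain ⟨η', hη', hy⟩ := hy
  obtain ⟨t, h1, h2⟩ := (hx.and hy).exists
  have v := Classical.arbitrary V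
  rw [← h1 v, ← h2 v, hP.path_unique hη hη' rfl rfl]

/-- When the model started from distinct opinions reaches consensus on `a`, the consensus opinion
is always the initial opinion of `a`. -/
lemma IsRegular.existsUnique_consensus [Nonempty V] {P : Ticks G} (hP : IsRegular P) {a : V}
    (ha : IsConsensus P id a) (η₀ : V → S) : ∃! x, IsConsensus P η₀ x :=
  ⟨η₀ a, ha.comp η₀, fun _ hy => hP.consensus_unique hy (ha.comp η₀)⟩

lemma IsRegular.consensus_eq [Nonempty V] [Nonempty S] {P : Ticks G} (hP : IsRegular P) {a : V}
    (ha : IsConsensus P id a) (η₀ : V → S) : consensus P η₀ = η₀ a :=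
  hP.consensus_unique (Classical.epsilon_spec ⟨_, ha.comp η₀⟩) (ha.comp η₀)

/-- Consensus is absorbing. -/
lemma IsRegular.isConsensus_of_const {P : Ticks G} (hP : IsRegular P) {η₀ : V → S}
    {η : ℝ≥0 → V → S} (hη : IsVoterPath P η₀ η) {s : ℝ≥0} {x : S} (hs : ∀ v, η s v = x) :
    IsConsensus P η₀ x := by
  refine ⟨η, hη, (eventually_ge_atTop s).mono fun t hst v => ?_⟩
  obtain ⟨φ, hφ⟩ := hP.exists_flow (S := S) s t hst
  rw [hφ P η₀ η rfl hη, Function.comp_apply, hs]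

end Paths

/-! ### Spreading lists of ticks and the dyadic grid -/

section Grid

variable {V : Type u} {G : SimpleGraph V} {S : Type v}

/-- The composed effect of successive ticks. -/
noncomputable def flowOf (l : List G.Dart) : V → V := l.foldl (fun φ e => φ ∘ copyMap e) id

lemma flowOf_concat (l : List G.Dart) (e : G.Dart) : flowOf (l ++ [e]) = flowOf l ∘ copyMap e := by
  simp [flowOf, List.foldl_append]

/-- In a connected finite graph the opinion of `r` can be spread to all vertices. -/
lemma exists_spreading_list [Finite V] (hG : G.Connected) (r : V) :
    ∃ l : List G.Dart, ∀ v, flowOf l v = r := by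
  -- Induction on the number of vertices outside a set `A` that already holds the opinion of `r`. A
  -- walk from `r` to a vertex outside crosses a boundary dart of `A`, and a tick of that dart
  -- enlarges `A`.
  have key : ∀ n : ℕ, ∀ A : Set V, r ∈ A → Aᶜ.ncard = n →
      (∃ l : List G.Dart, ∀ v ∈ A, flowOf l v = r) → ∃ l : List G.Dart, ∀ v, flowOf l v = r := by
    intro n
    induction n with
    | zero =>
      rintro A - hA ⟨l, hl⟩
      have : A = univ := by
        rw [ncard_eq_zero (toFinite _)] at hA
        simpa using hA
      exact ⟨l, fun v => hl v (this ▸ mem_univ v)⟩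
    | succ n ih =>
      rintro A hr hA ⟨l, hl⟩
      obtain ⟨v, hv⟩ : (Aᶜ).Nonempty := by
        rw [← ncard_pos (toFinite _)]
        omega
      obtain ⟨p⟩ := hG.preconnected r v
      obtain ⟨e, -, he1, he2⟩ := p.exists_boundary_dart A hr hv
      refine ih (insert e.snd A) (mem_insert_of_mem _ hr) ?_ ⟨l ++ [e], ?_⟩
      · have : (insert e.snd A)ᶜ = Aᶜ \ {e.snd} := by
          ext x
          simp [and_comm]
        rw [this, ncard_sdiff_singleton_of_mem he2, hA]
        rfl
      · intro x hx
        rw [flowOf_concat, Function.comp_apply]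
        by_cases hxe : x = e.snd
        · rw [hxe, copyMap_snd]
          exact hl _ he1
        · rw [copyMap_of_ne e hxe]
          exact hl _ (hx.resolve_left hxe)
  exact key _ {r} rfl rfl ⟨[], fun v hv => hv⟩

/-- The number of ticks of `e` during `(s, t]`. -/
noncomputable def tickCount (P : Ticks G) (e : G.Dart) (s t : ℝ≥0) : ℕ∞ :=
  (P ∩ ({e} ×ˢ Ioc s t)).encard

lemma tickCount_eq_zero {P : Ticks G} {e : G.Dart} {s t : ℝ≥0} :
    tickCount P e s t = 0 ↔ ∀ r ∈ Ioc s t, (e, r) ∉ P := by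
  rw [tickCount, encard_eq_zero, eq_empty_iff_forall_notMem]
  constructor
  · intro h r hr he
    exact h (e, r) ⟨he, rfl, hr⟩
  · rintro h ⟨e', r⟩ ⟨he, rfl, hr⟩
    exact h r hr he

lemma window_eq_empty {P : Ticks G} {s t : ℝ≥0} (h : ∀ e, tickCount P e s t = 0) :
    P ∩ window G s t = ∅ :=
  eq_empty_iff_forall_notMem.2 fun x hx => tickCount_eq_zero.1 (h x.1) x.2 hx.2 hx.1

lemma window_eq_singleton {P : Ticks G} {s t : ℝ≥0} {e : G.Dart} (h1 : tickCount P e s t = 1)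
    (h : ∀ e', e' ≠ e → tickCount P e' s t = 0) : ∃ r, P ∩ window G s t = {(e, r)} := by
  obtain ⟨⟨e', r⟩, hx⟩ := encard_eq_one.1 h1
  have hmem : (e', r) ∈ P ∩ ({e} ×ˢ Ioc s t) := by simp [hx]
  obtain rfl : e' = e := hmem.2.1
  refine ⟨r, ?_⟩
  rw [← hx]
  ext ⟨e'', q⟩
  constructor
  · rintro ⟨hP, hw⟩
    refine ⟨hP, ?_, hw⟩
    by_contra hne
    exact tickCount_eq_zero.1 (h e'' hne) q hw hP
  · rintro ⟨hP, -, hw⟩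
    exact ⟨hP, hw⟩

/-- When the ticks of successive unit time intervals follow `l`, so do the opinions. -/
lemma IsVoterPath.eq_flowOf {P : Ticks G} {η₀ : V → S} {η : ℝ≥0 → V → S}
    (hη : IsVoterPath P η₀ η) (b : ℝ≥0) (l : List G.Dart)
    (h : ∀ (i : ℕ) (hi : i < l.length), ∃ r, P ∩ window G (b + i) (b + i + 1) = {(l[i], r)}) :
    η (b + l.length) = η b ∘ flowOf l := by
  have key : ∀ i, i ≤ l.length → η (b + i) = η b ∘ flowOf (l.take i) := by
    intro i
    induction i with
    | zero => simp [flowOf]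
    | succ i ih =>
      intro hi
      obtain ⟨r, hr⟩ := h i hi
      rw [Nat.cast_succ, ← add_assoc, hη.eq_of_singleton hr, ih (by omega),
        List.take_succ_eq_append_getElem (by omega), flowOf_concat, Function.comp_assoc]
  simpa using key l.length le_rfl

/-- The points of the dyadic grid. -/
noncomputable def gridTime (k j : ℕ) : ℝ≥0 := j / 2 ^ k

lemma gridTime_zero (k : ℕ) : gridTime k 0 = 0 := by simp [gridTime]

lemma gridTime_lt_succ (k j : ℕ) : gridTime k j < gridTime k (j + 1) := by
  unfold gridTime
  gcongr
  simp

lemma gridTime_mono (k : ℕ) : Monotone (gridTime k) := fun i j h => by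
  unfold gridTime
  gcongr

lemma gridTime_mul (k : ℕ) : gridTime k (k * 2 ^ k) = k := by
  simp [gridTime]

lemma exists_mem_cell {k m : ℕ} {t : ℝ≥0} (h0 : 0 < t) (ht : t ≤ gridTime k m) :
    ∃ j < m, t ∈ Ioc (gridTime k j) (gridTime k (j + 1)) := by
  induction m with
  | zero => simp [gridTime_zero, h0.not_ge] at ht
  | succ m ih =>
    by_cases h : t ≤ gridTime k m
    · obtain ⟨j, hj, hj'⟩ := ih h
      exact ⟨j, by omega, hj'⟩
    · exact ⟨m, by omega, not_le.1 h, ht⟩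

/-- For all fine enough dyadic grids, every cell contains at most one point of `P` and `Q`
together. -/
def IsSparse (P Q : Ticks G) : Prop :=
  ∀ᶠ k in atTop, ∀ j < k * 2 ^ k,
    (P ∩ window G (gridTime k j) (gridTime k (j + 1))).encard +
      (Q ∩ window G (gridTime k j) (gridTime k (j + 1))).encard ≤ 1

/-- The level-`k` grid reaches time `k`, hence beyond any given `t`. Up to `t` the points lie in
finitely many cells with at most one point each, and simultaneous points would share a cell. -/
lemma IsSparse.isRegular {P Q : Ticks G} (h : IsSparse P Q) : IsRegular (P ∪ Q) := by
  have h' : ∀ᶠ k in atTop, ∀ j < k * 2 ^ k,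
      ((P ∪ Q) ∩ window G (gridTime k j) (gridTime k (j + 1))).encard ≤ 1 := by
    filter_upwards [h] with k hk j hj
    rw [union_inter_distrib_right]
    exact (encard_union_le _ _).trans (hk j hj)
  have hk : ∀ t : ℝ≥0, ∃ k : ℕ, t ≤ gridTime k (k * 2 ^ k) ∧ ∀ j < k * 2 ^ k,
      ((P ∪ Q) ∩ window G (gridTime k j) (gridTime k (j + 1))).encard ≤ 1 := fun t => by
    obtain ⟨k, hk, hk'⟩ := (h'.and (eventually_ge_atTop ⌈t⌉₊)).exists
    exact ⟨k, by rw [gridTime_mul]; exact Nat.ceil_le.1 hk', hk⟩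
  constructor
  · intro t
    obtain ⟨k, ht, hk⟩ := hk t
    refine (finite_iUnion (ι := Fin (k * 2 ^ k)) fun j =>
      finite_of_encard_le_coe (hk j j.2)).subset fun x hx => ?_
    obtain ⟨j, hj, hj'⟩ := exists_mem_cell hx.2.1 (hx.2.2.trans ht)
    exact mem_iUnion.2 ⟨⟨j, hj⟩, hx.1, hj'⟩
  · intro x hx y hy h0 hxy
    obtain ⟨k, ht, hk⟩ := hk x.2
    obtain ⟨j, hj, hj'⟩ := exists_mem_cell h0 ht
    exact encard_le_one_iff.1 (hk j hj) x y ⟨hx, hj'⟩ ⟨hy, by rw [hxy] at hj'; exact hj'⟩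

end Grid

/-! ### The discretized pair of trajectories -/

section Chain

variable {V : Type u} {G : SimpleGraph V}

/-- `l` is the only label with a tick, and it ticks once. -/
def IsSole {L : Type*} (c : L → ℕ∞) (l : L) : Prop := c l = 1 ∧ ∀ l', l' ≠ l → c l' = 0

lemma IsSole.unique {L : Type*} {c : L → ℕ∞} {l l' : L} (h : IsSole c l) (h' : IsSole c l') :
    l' = l := by
  by_contra hne
  simpa [h'.1] using h.2 l' hne

/-- The joint effect of a tick on the opinions driven by the original clocks and those driven by
the perturbed clocks. Labels on the left are ticks of the original clocks, labels on the right
are additional ticks; `d e` tells whether an original tick of `e` is deleted. -/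
noncomputable def tickMap (d : G.Dart → Bool) :
    G.Dart ⊕ G.Dart → (V → V) × (V → V) → (V → V) × (V → V)
  | .inl e, s => (s.1 ∘ copyMap e, if d e then s.2 else s.2 ∘ copyMap e)
  | .inr e, s => (s.1, s.2 ∘ copyMap e)

open Classical in
/-- The joint effect of the ticks of a time cell, where cells with several ticks are ignored. -/
noncomputable def cellStep (c : G.Dart ⊕ G.Dart → ℕ∞) (d : G.Dart → Bool)
    (s : (V → V) × (V → V)) : (V → V) × (V → V) :=
  if h : ∃ l, IsSole c l then tickMap d h.choose s else s

lemma cellStep_of_isSole {c : G.Dart ⊕ G.Dart → ℕ∞} {d : G.Dart → Bool} {l : G.Dart ⊕ G.Dart}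
    (h : IsSole c l) (s : (V → V) × (V → V)) : cellStep c d s = tickMap d l s := by
  have hex : ∃ l, IsSole c l := ⟨l, h⟩
  rw [cellStep, dif_pos hex, h.unique hex.choose_spec]

lemma cellStep_of_not {c : G.Dart ⊕ G.Dart → ℕ∞} {d : G.Dart → Bool}
    (h : ¬ ∃ l, IsSole c l) (s : (V → V) × (V → V)) : cellStep c d s = s := dif_neg h

/-- The number of original ticks of `e` before the `j`-th cell. -/
noncomputable def startIndex (c : ℕ → G.Dart ⊕ G.Dart → ℕ∞) (j : ℕ) (e : G.Dart) : ℕ :=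
  ∑ i ∈ Finset.range j, (c i (.inl e)).toNat

/-- The discretized pair of trajectories started from distinct opinions. -/
noncomputable def chain (c : ℕ → G.Dart ⊕ G.Dart → ℕ∞) (del : G.Dart × ℕ → Bool) :
    ℕ → (V → V) × (V → V)
  | 0 => (id, id)
  | j + 1 => cellStep (c j) (fun e => del (e, startIndex c j e)) (chain c del j)

/-- The numbers of ticks in a cell of the dyadic grid. -/
noncomputable def cellCount (P Q : Ticks G) (k j : ℕ) : G.Dart ⊕ G.Dart → ℕ∞ :=
  Sum.elim (fun e => tickCount P e (gridTime k j) (gridTime k (j + 1)))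
    (fun e => tickCount Q e (gridTime k j) (gridTime k (j + 1)))

/-- The ticks of `e`, as a set of times, are counted by the cells. -/
lemma ncard_ticks_eq_startIndex {P Q : Ticks G} (hP : IsRegular P) (hP0 : ∀ e, (e, 0) ∉ P)
    (k j : ℕ) (e : G.Dart) :
    {s : ℝ≥0 | (e, s) ∈ P ∧ s ≤ gridTime k j}.ncard = startIndex (cellCount P Q k) j e := by
  induction j with
  -- The cells are half-open and miss time `0`. A tick there would be counted as an earlier tick but
  -- lie in no cell, whence `hP0`.
  | zero =>
    rw [startIndex, Finset.range_zero, Finset.sum_empty, gridTime_zero]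
    convert ncard_empty ℝ≥0
    ext s
    simp only [mem_ofPred_eq, mem_empty_iff_false, iff_false, not_and]
    intro hs h0
    exact hP0 e (nonpos_iff_eq_zero.1 h0 ▸ hs)
  | succ j ih =>
    have hfin : ∀ t, {s : ℝ≥0 | (e, s) ∈ P ∧ s ≤ t}.Finite := fun t => by
      refine ((hP.finite t).image Prod.snd).subset fun s hs => ⟨(e, s), ⟨hs.1, ?_, hs.2⟩, rfl⟩
      exact pos_of_ne_zero fun h => hP0 e (h ▸ hs.1)
    have hsplit : {s : ℝ≥0 | (e, s) ∈ P ∧ s ≤ gridTime k (j + 1)} =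
        {s : ℝ≥0 | (e, s) ∈ P ∧ s ≤ gridTime k j} ∪
          {s : ℝ≥0 | (e, s) ∈ P ∧ s ∈ Ioc (gridTime k j) (gridTime k (j + 1))} := by
      have := (gridTime_lt_succ k j).le
      ext s
      simp only [mem_ofPred_eq, mem_union, mem_Ioc]
      grind
    rw [hsplit, ncard_union_eq (disjoint_left.2 fun s hs hs' => absurd hs.2 (not_le.2 hs'.2.1))
        (hfin _) ((hfin (gridTime k (j + 1))).subset fun s hs => ⟨hs.1, hs.2.2⟩),
      ih, startIndex, startIndex, Finset.sum_range_succ]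
    · congr 1
      have : P ∩ ({e} ×ˢ Ioc (gridTime k j) (gridTime k (j + 1))) = Prod.mk e ''
          {s : ℝ≥0 | (e, s) ∈ P ∧ s ∈ Ioc (gridTime k j) (gridTime k (j + 1))} := by
        ext ⟨e', s⟩
        simp only [mem_inter_iff, mem_prod, mem_singleton_iff, mem_image, mem_ofPred_eq,
          Prod.mk.injEq]
        constructor
        · rintro ⟨h, rfl, h'⟩
          exact ⟨s, ⟨h, h'⟩, rfl, rfl⟩
        · rintro ⟨s, ⟨h, h'⟩, rfl, rfl⟩
          exact ⟨h, rfl, h'⟩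
      simp only [cellCount, Sum.elim_inl, tickCount]
      rw [this, (Prod.mk_right_injective e).encard_image, ncard]

lemma tickCount_singleton {P : Ticks G} {e : G.Dart} {s t r : ℝ≥0}
    (h : P ∩ window G s t = {(e, r)}) :
    tickCount P e s t = 1 ∧ ∀ e', e' ≠ e → tickCount P e' s t = 0 := by
  have hmem : (e, r) ∈ P ∩ window G s t := by simp [h]
  constructor
  · rw [tickCount, encard_eq_one]
    refine ⟨(e, r), subset_antisymm (fun x hx => ?_) ?_⟩
    · rw [← h]
      exact ⟨hx.1, hx.2.2⟩
    · rintro _ rfl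
      exact ⟨hmem.1, rfl, hmem.2⟩
  · intro e' he'
    rw [tickCount_eq_zero]
    intro q hq hP
    have : (e', q) ∈ P ∩ window G s t := ⟨hP, hq⟩
    rw [h] at this
    exact he' (Prod.mk.inj this).1

lemma tickCount_of_window_empty {P : Ticks G} {s t : ℝ≥0} (h : P ∩ window G s t = ∅)
    (e : G.Dart) : tickCount P e s t = 0 := by
  rw [tickCount_eq_zero]
  intro q hq hP
  have : (e, q) ∈ P ∩ window G s t := ⟨hP, hq⟩
  simp [h] at this

/-- On a fine grid, the discretized trajectories are the true ones. -/
lemma chain_eq {P Q : Ticks G} {del : G.Dart × ℕ → Bool} (hreg : IsRegular P)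
    (hP0 : ∀ e, (e, 0) ∉ P) {k m : ℕ}
    (hk : ∀ j < m, (P ∩ window G (gridTime k j) (gridTime k (j + 1))).encard +
      (Q ∩ window G (gridTime k j) (gridTime k (j + 1))).encard ≤ 1)
    {η η' : ℝ≥0 → V → V} (hη : IsVoterPath P id η)
    (hη' : IsVoterPath (thinning P del ∪ Q) id η') {j : ℕ} (hj : j ≤ m) :
    chain (cellCount P Q k) del j = (η (gridTime k j), η' (gridTime k j)) := by
  induction j with
  | zero => simp [chain, gridTime_zero, hη.init, hη'.init]
  | succ j ih =>
    specialize ih (by omega)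
    specialize hk j (by omega)
    have hle := (gridTime_lt_succ k j).le
    rw [chain, ih]
    set s := gridTime k j with hs
    set t := gridTime k (j + 1) with ht
    have hthin : thinning P del ⊆ P := fun x hx => hx.1
    rcases (P ∩ window G s t).eq_empty_or_nonempty with hPe | hPne
    · have hnoisy : (thinning P del ∪ Q) ∩ window G s t = Q ∩ window G s t := by
        rw [union_inter_distrib_right, subset_empty_iff.1
          ((inter_subset_inter_left _ hthin).trans hPe.subset), empty_union]
      rcases (Q ∩ window G s t).eq_empty_or_nonempty with hQe | hQne
      · rw [cellStep_of_not, hη.eq_of_empty hle hPe, hη'.eq_of_empty hle (hnoisy.trans hQe)]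
        rintro ⟨l | l, hl, -⟩
        · rw [cellCount, Sum.elim_inl, ← hs, ← ht, tickCount_of_window_empty hPe] at hl
          simp at hl
        · rw [cellCount, Sum.elim_inr, ← hs, ← ht, tickCount_of_window_empty hQe] at hl
          simp at hl
      · have h1 : (Q ∩ window G s t).encard = 1 :=
          le_antisymm (le_add_self.trans hk) (one_le_encard_iff_nonempty.2 hQne)
        obtain ⟨⟨e, r⟩, her⟩ := encard_eq_one.1 h1
        have hsole : IsSole (cellCount P Q k j) (.inr e) := by
          refine ⟨(tickCount_singleton her).1, ?_⟩
          rintro (e' | e') he'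
          · exact tickCount_of_window_empty hPe e'
          · exact (tickCount_singleton her).2 e' fun h => he' (h ▸ rfl)
        rw [cellStep_of_isSole hsole, tickMap, hη.eq_of_empty hle hPe,
          hη'.eq_of_singleton (hnoisy.trans her)]
    · have h1 : (P ∩ window G s t).encard = 1 :=
        le_antisymm (le_self_add.trans hk) (one_le_encard_iff_nonempty.2 hPne)
      have hQe : Q ∩ window G s t = ∅ := by
        by_contra hne
        have := one_le_encard_iff_nonempty.2 (nonempty_iff_ne_empty.2 hne)
        have h2 : (1 : ℕ∞) + 1 ≤ 1 := (add_le_add h1.ge this).trans hk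
        exact absurd h2 (by decide)
      obtain ⟨⟨e, r⟩, her⟩ := encard_eq_one.1 h1
      have hmem : (e, r) ∈ P ∩ window G s t := by simp [her]
      have hsole : IsSole (cellCount P Q k j) (.inl e) := by
        refine ⟨(tickCount_singleton her).1, ?_⟩
        rintro (e' | e') he'
        · exact (tickCount_singleton her).2 e' fun h => he' (h ▸ rfl)
        · exact tickCount_of_window_empty hQe e'
      -- As `r` is the only tick of its cell, the earlier ticks of `e` are those up to the left end
      -- of the cell. So the chain and `thinning` read the same deletion mark.
      have hindex : tickIndex P (e, r) = startIndex (cellCount P Q k) j e := by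
        rw [← ncard_ticks_eq_startIndex hreg hP0, tickIndex]
        congr 1
        ext q
        simp only [mem_ofPred_eq]
        refine and_congr_right fun hq => ⟨fun hqr => ?_, fun hqs => lt_of_le_of_lt hqs hmem.2.1⟩
        by_contra hsq
        have : (e, q) ∈ P ∩ window G s t := ⟨hq, not_le.1 hsq, hqr.le.trans hmem.2.2⟩
        rw [her] at this
        exact hqr.ne (Prod.mk.inj this).2
      rw [cellStep_of_isSole hsole, tickMap, hη.eq_of_singleton her, ← hindex]
      congr 1
      have hnoisy : (thinning P del ∪ Q) ∩ window G s t = thinning P del ∩ window G s t := by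
        rw [union_inter_distrib_right, hQe, union_empty]
      have hsub : thinning P del ∩ window G s t ⊆ {(e, r)} :=
        (inter_subset_inter_left _ hthin).trans her.subset
      split_ifs with hd
      · rw [hη'.eq_of_empty hle]
        rw [hnoisy, eq_empty_iff_forall_notMem]
        intro x hx
        obtain rfl : x = (e, r) := hsub hx
        have := hx.1.2
        simp [hd] at this
      · refine (hη'.eq_of_singleton (e := e) (r := r) ?_).symm
        rw [hnoisy]
        refine subset_antisymm hsub ?_
        rintro _ rfl
        exact ⟨⟨hmem.1, by simpa using hd⟩, hmem.2⟩

end Chain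

/-! ### Independence and the two Borel–Cantelli lemmas -/

section Independence

variable {Ω : Type w} {mΩ : MeasurableSpace Ω} {μ : Measure Ω}

/-- Two independent families that are independent of one another form an independent family. -/
lemma iIndep_sumElim {ι κ : Type*} {m : ι → MeasurableSpace Ω} {m' : κ → MeasurableSpace Ω}
    {M M' : MeasurableSpace Ω} (hm : iIndep m μ) (hm' : iIndep m' μ) (h : Indep M M' μ)
    (hM : ∀ i, m i ≤ M) (hM' : ∀ i, m' i ≤ M') : iIndep (Sum.elim m m') μ := by
  classical
  rw [iIndep_iff]
  intro s f hf
  have hl : ∀ i ∈ s.toLeft, MeasurableSet[m i] (f (.inl i)) := fun i hi =>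
    hf _ (Finset.mem_toLeft.1 hi)
  have hr : ∀ i ∈ s.toRight, MeasurableSet[m' i] (f (.inr i)) := fun i hi =>
    hf _ (Finset.mem_toRight.1 hi)
  have hsplit : ⋂ i ∈ s, f i = (⋂ i ∈ s.toLeft, f (.inl i)) ∩ ⋂ i ∈ s.toRight, f (.inr i) := by
    ext ω
    simp only [mem_iInter, mem_inter_iff, Finset.mem_toLeft, Finset.mem_toRight, Sum.forall]
  rw [hsplit, (Indep_iff _ _ _).1 h, (iIndep_iff _ _).1 hm _ hl, (iIndep_iff _ _).1 hm' _ hr]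
  · conv_rhs => rw [← Finset.toLeft_disjSum_toRight (u := s), Finset.prod_disjSum]
  · exact Finset.measurableSet_biInter _ fun i hi => hM i _ (hl i hi)
  · exact Finset.measurableSet_biInter _ fun i hi => hM' i _ (hr i hi)

/-- Among independent trials of a finite pattern of positive probability, one succeeds. -/
lemma ae_exists_pattern {γ : Type*} [Fintype γ] {X : ℕ × γ → Ω → ℕ∞}
    (hX : ∀ i, Measurable (X i)) (hind : iIndepFun X μ) (τ : γ → ℕ∞) (q : γ → ℝ≥0∞)
    (hq : ∀ c, q c ≠ 0) (hlaw : ∀ b c, μ {ω | X (b, c) ω = τ c} = q c) :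
    ∀ᵐ ω ∂μ, ∃ b, ∀ c, X (b, c) ω = τ c := by
  classical
  have := hind.isProbabilityMeasure
  set E : ℕ → Set Ω := fun b => ⋂ c, X (b, c) ⁻¹' {τ c} with hE
  have hEm : ∀ b, MeasurableSet (E b) := fun b =>
    MeasurableSet.iInter fun c => hX _ (measurableSet_singleton _)
  have hprod : ∀ s : Finset ℕ, μ (⋂ b ∈ s, E b) = ∏ b ∈ s, ∏ c, q c := by
    intro s
    have h1 : ⋂ b ∈ s, E b = ⋂ i ∈ s ×ˢ (Finset.univ : Finset γ), X i ⁻¹' {τ i.2} := by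
      ext ω
      simp only [hE, mem_iInter, Finset.mem_product, Finset.mem_univ, and_true, Prod.forall]
      exact ⟨fun h b c hb => h b hb c, fun h b hb c => h b c hb⟩
    rw [h1, hind.measure_inter_preimage_eq_mul _ fun i _ => measurableSet_singleton (τ i.2),
      Finset.prod_product]
    exact Finset.prod_congr rfl fun b _ => Finset.prod_congr rfl fun c _ => hlaw b c
  have hE1 : ∀ b, μ (E b) = ∏ c, q c := fun b => by simpa using hprod {b}
  have hindE : iIndepSet E μ := by
    rw [iIndepSet_iff_meas_biInter hEm]
    intro s
    rw [hprod]
    exact Finset.prod_congr rfl fun b _ => (hE1 b).symm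
  have hsum : ∑' b, μ (E b) = ∞ := by
    simp only [hE1]
    exact ENNReal.tsum_const_eq_top_of_ne_zero (Finset.prod_ne_zero_iff.2 fun c _ => hq c)
  -- Second Borel–Cantelli lemma: the trials are independent with the same positive probability.
  have h1 := measure_limsup_eq_one hEm hindE hsum
  have h2 : ∀ᵐ ω ∂μ, ω ∈ limsup E atTop := by
    rw [← mem_ae_iff_prob_eq_one (MeasurableSet.measurableSet_limsup hEm)] at h1
    exact h1
  filter_upwards [h2] with ω hω
  rw [mem_limsup_iff_frequently_mem] at hω
  obtain ⟨b, hb⟩ := hω.exists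
  exact ⟨b, fun c => mem_iInter.1 hb c⟩

/-- Events of probability `O(4⁻ᵏ)` indexed by the cells of the dyadic grids occur in finitely many
grids only. -/
lemma ae_eventually_forall_cell {B : ℕ → ℕ → Set Ω} {C : ℝ}
    (h : ∀ k j, μ (B k j) ≤ ENNReal.ofReal (C * ((2 : ℝ) ^ k)⁻¹ ^ 2)) :
    ∀ᵐ ω ∂μ, ∀ᶠ k in atTop, ∀ j < k * 2 ^ k, ω ∉ B k j := by
  -- Level `k` has `k * 2 ^ k` cells, so the union bound is of order `k 2⁻ᵏ`, which is summable.
  have hle : ∀ k, μ (⋃ j ∈ Finset.range (k * 2 ^ k), B k j) ≤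
      ENNReal.ofReal (C * (k * (1 / 2) ^ k)) := by
    intro k
    refine (measure_biUnion_finset_le _ _).trans ((Finset.sum_le_sum fun j _ => h k j).trans ?_)
    rw [Finset.sum_const, Finset.card_range, ← ENNReal.ofReal_nsmul]
    refine le_of_eq ?_
    congr 1
    rw [nsmul_eq_mul]
    push_cast
    rw [one_div, inv_pow 2 k]
    field_simp
  have hsum : Summable fun k : ℕ => C * (k * (1 / 2 : ℝ) ^ k) := by
    refine Summable.mul_left C ?_
    simpa using summable_pow_mul_geometric_of_norm_lt_one (R := ℝ) 1 (r := 1 / 2) (by norm_num)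
  have := ae_eventually_notMem (μ := μ) (s := fun k => ⋃ j ∈ Finset.range (k * 2 ^ k), B k j)
    (ne_top_of_le_ne_top hsum.tsum_ofReal_ne_top (ENNReal.tsum_le_tsum hle))
  filter_upwards [this] with ω hω
  filter_upwards [hω] with k hk j hj hB
  exact hk (mem_biUnion (Finset.mem_coe.2 (Finset.mem_range.2 hj)) hB)

end Independence

/-! ### Counts of a Poisson point process -/

section Poisson

variable {X : Type u} [MeasurableSpace X] {Ω : Type w} [MeasurableSpace Ω] {μ : Measure Ω}
  {ν : Measure X} {N : Ω → Set X}

/-- Independence of an infinite family is a condition on its finite subfamilies, which are reindexed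
by `Fin` to fit `count_indep`. -/
lemma IsPoissonPointProcess.iIndepFun_count (h : IsPoissonPointProcess ν N μ) {ι : Type*}
    (A : ι → Set X) (hA : ∀ i, MeasurableSet (A i)) (hd : Pairwise fun i j => Disjoint (A i) (A j)) :
    iIndepFun (fun i ω => (N ω ∩ A i).encard) μ := by
  rw [iIndepFun_iff_finset]
  intro s
  have := h.count_indep s.card (fun i => A (s.equivFin.symm i)) (fun i => hA _)
    fun i j hij => hd fun h => hij (s.equivFin.symm.injective (Subtype.ext h))
  have h2 := this.precomp s.equivFin.injective
  simpa [Finset.restrict_def] using h2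

lemma IsPoissonPointProcess.count_zero (h : IsPoissonPointProcess ν N μ) {A : Set X}
    (hA : MeasurableSet A) {r : ℝ} (hr : 0 ≤ r) (hν : ν A = ENNReal.ofReal r) :
    μ {ω | (N ω ∩ A).encard = 0} = ENNReal.ofReal (Real.exp (-r)) := by
  have := h.count_law A hA (by simp [hν]) 0
  rw [hν] at this
  have hcoe : ((ENNReal.ofReal r).toNNReal : ℝ) = r := ENNReal.toReal_ofReal hr
  simpa [poissonMeasure_singleton, hcoe] using this

lemma IsPoissonPointProcess.count_one (h : IsPoissonPointProcess ν N μ) {A : Set X}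
    (hA : MeasurableSet A) {r : ℝ} (hr : 0 ≤ r) (hν : ν A = ENNReal.ofReal r) :
    μ {ω | (N ω ∩ A).encard = 1} = ENNReal.ofReal (Real.exp (-r) * r) := by
  have := h.count_law A hA (by simp [hν]) 1
  rw [hν] at this
  have hcoe : ((ENNReal.ofReal r).toNNReal : ℝ) = r := ENNReal.toReal_ofReal hr
  simpa [poissonMeasure_singleton, hcoe] using this

lemma IsPoissonPointProcess.measurableSet_count (h : IsPoissonPointProcess ν N μ) {A : Set X}
    (hA : MeasurableSet A) (k : ℕ∞) : MeasurableSet {ω | (N ω ∩ A).encard = k} :=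
  h.measurable_count A hA (measurableSet_singleton k)

lemma IsPoissonPointProcess.count_ne_zero_le [IsProbabilityMeasure μ]
    (h : IsPoissonPointProcess ν N μ) {A : Set X}
    (hA : MeasurableSet A) {r : ℝ} (hr : 0 ≤ r) (hν : ν A = ENNReal.ofReal r) :
    μ {ω | (N ω ∩ A).encard ≠ 0} ≤ ENNReal.ofReal r := by
  have h0 := h.count_zero hA hr hν
  rw [show {ω | (N ω ∩ A).encard ≠ 0} = {ω | (N ω ∩ A).encard = 0}ᶜ from rfl,
    prob_compl_eq_one_sub (h.measurableSet_count hA 0), h0, ← ENNReal.ofReal_one,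
    ← ENNReal.ofReal_sub _ (Real.exp_pos _).le]
  refine ENNReal.ofReal_le_ofReal ?_
  linarith [Real.add_one_le_exp (-r)]

/-- The probability is `1 - e⁻ʳ (1 + r)`, and `e⁻ʳ ≥ 1 - r` bounds it by `1 - (1 - r)(1 + r) = r²`.
The second order in `r` is what makes the sum over all grid cells converge. -/
lemma IsPoissonPointProcess.count_gt_one_le [IsProbabilityMeasure μ]
    (h : IsPoissonPointProcess ν N μ) {A : Set X}
    (hA : MeasurableSet A) {r : ℝ} (hr : 0 ≤ r) (hν : ν A = ENNReal.ofReal r) :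
    μ {ω | ¬ (N ω ∩ A).encard ≤ 1} ≤ ENNReal.ofReal (r ^ 2) := by
  have h0 := h.count_zero hA hr hν
  have h1 := h.count_one hA hr hν
  have hset : {ω | ¬ (N ω ∩ A).encard ≤ 1} =
      ({ω | (N ω ∩ A).encard = 0} ∪ {ω | (N ω ∩ A).encard = 1})ᶜ := by
    ext ω
    simp only [mem_ofPred_eq, mem_compl_iff, mem_union, Order.le_one_iff]
  have hdisj : Disjoint {ω | (N ω ∩ A).encard = 0} {ω | (N ω ∩ A).encard = 1} :=
    disjoint_left.2 fun ω h0 h1 => by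
      rw [mem_ofPred_eq] at h0 h1
      simp [h0] at h1
  rw [hset, prob_compl_eq_one_sub ((h.measurableSet_count hA 0).union (h.measurableSet_count hA 1)),
    measure_union hdisj (h.measurableSet_count hA 1), h0, h1,
    ← ENNReal.ofReal_add (Real.exp_pos _).le (mul_nonneg (Real.exp_pos _).le hr),
    ← ENNReal.ofReal_one,
    ← ENNReal.ofReal_sub _ (add_nonneg (Real.exp_pos _).le (mul_nonneg (Real.exp_pos _).le hr))]
  refine ENNReal.ofReal_le_ofReal ?_
  nlinarith [Real.add_one_le_exp (-r), mul_nonneg hr hr,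
    mul_le_mul_of_nonneg_right (Real.add_one_le_exp (-r)) (by linarith : 0 ≤ 1 + r)]

lemma IsPoissonPointProcess.ae_empty [IsProbabilityMeasure μ] (h : IsPoissonPointProcess ν N μ)
    {A : Set X} (hA : MeasurableSet A) (hν : ν A = 0) : ∀ᵐ ω ∂μ, N ω ∩ A = ∅ := by
  have := h.count_ne_zero_le hA (r := 0) le_rfl (by simpa using hν)
  rw [ENNReal.ofReal_zero, nonpos_iff_eq_zero] at this
  filter_upwards [measure_eq_zero_iff_ae_notMem.1 this] with ω hω
  simpa using hω

end Poisson

/-! ### Generated σ-algebras, Bernoulli marks and the clock intensity -/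

section ConfigSigma

variable {X : Type u} [MeasurableSpace X] {Ω : Type w} {ν : Measure X} {N : Ω → Set X}

lemma comap_count_le_sigmaOfConfig {A : Set X} (hA : MeasurableSet A) :
    MeasurableSpace.comap (fun ω => (N ω ∩ A).encard) inferInstance ≤ sigmaOfConfig N := by
  have : (fun ω => (N ω ∩ A).encard) = (fun M : Set X => (M ∩ A).encard) ∘ N := rfl
  rw [this, ← MeasurableSpace.comap_comp]
  exact MeasurableSpace.comap_mono (le_iSup (fun A : {A : Set X // MeasurableSet A} =>
    MeasurableSpace.comap (fun N : Set X => (N ∩ A.1).encard) inferInstance) ⟨A, hA⟩)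

lemma IsPoissonPointProcess.sigmaOfConfig_le {mΩ : MeasurableSpace Ω} {μ : Measure Ω}
    (h : IsPoissonPointProcess ν N μ) : sigmaOfConfig N ≤ mΩ := by
  rw [sigmaOfConfig, MeasurableSpace.comap_iSup]
  refine iSup_le fun A => ?_
  rw [MeasurableSpace.comap_comp]
  exact (h.measurable_count A.1 A.2).comap_le

end ConfigSigma

section Bernoulli

variable {ι : Type u} {Ω : Type w} {mΩ : MeasurableSpace Ω} {μ : Measure Ω} {p : ℝ}
  {X : ι → Ω → Bool}

lemma comap_le_sigmaOf (X : ι → Ω → Bool) (i : ι) :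
    MeasurableSpace.comap (X i) inferInstance ≤ sigmaOf X := by
  have : X i = (fun f : ι → Bool => f i) ∘ fun ω i => X i ω := rfl
  rw [this, ← MeasurableSpace.comap_comp]
  exact MeasurableSpace.comap_mono (measurable_pi_apply i).comap_le

lemma IsBernoulliFamily.sigmaOf_le (h : IsBernoulliFamily p X μ) : sigmaOf X ≤ mΩ :=
  (measurable_pi_lambda _ h.measurable).comap_le

lemma IsBernoulliFamily.measureReal_true (h : IsBernoulliFamily p X μ) (hp : 0 ≤ p) (i : ι) :
    μ.real {ω | X i ω = true} = p := by
  rw [measureReal_def, h.law, ENNReal.toReal_ofReal hp]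

lemma IsBernoulliFamily.measureReal_false [IsProbabilityMeasure μ] (h : IsBernoulliFamily p X μ)
    (hp : 0 ≤ p) (i : ι) : μ.real {ω | X i ω = false} = 1 - p := by
  have hm : MeasurableSet {ω | X i ω = true} := h.measurable i (measurableSet_singleton true)
  rw [← h.measureReal_true hp i, ← probReal_compl_eq_one_sub hm]
  congr 1
  ext ω
  simp

end Bernoulli

section Clocks

variable {V : Type u} {G : SimpleGraph V}

instance finite_dart [Finite V] : Finite G.Dart :=
  Finite.of_injective _ SimpleGraph.Dart.toProd_injective

instance : MeasurableSingletonClass G.Dart := ⟨fun _ => trivial⟩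

lemma measurableEmbedding_coe : MeasurableEmbedding ((↑) : ℝ≥0 → ℝ) :=
  MeasurableEmbedding.subtype_coe measurableSet_Ici

lemma lebesgue_Ioc (s t : ℝ≥0) :
    Measure.comap ((↑) : ℝ≥0 → ℝ) volume (Ioc s t) = ENNReal.ofReal (t - s) := by
  rw [measurableEmbedding_coe.comap_apply, NNReal.image_coe_Ioc, Real.volume_Ioc]

lemma lebesgue_singleton (s : ℝ≥0) :
    Measure.comap ((↑) : ℝ≥0 → ℝ) volume ({s} : Set ℝ≥0) = 0 := by
  rw [measurableEmbedding_coe.comap_apply, image_singleton, Real.volume_singleton]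

instance sigmaFinite_lebesgue :
    SigmaFinite (Measure.comap ((↑) : ℝ≥0 → ℝ) volume) := by
  have h : SigmaFinite ((Measure.comap ((↑) : ℝ≥0 → ℝ) volume).map ((↑) : ℝ≥0 → ℝ)) := by
    rw [measurableEmbedding_coe.map_comap]
    infer_instance
  exact SigmaFinite.of_map _ measurableEmbedding_coe.measurable.aemeasurable h

lemma measurableSet_window (s t : ℝ≥0) : MeasurableSet (window G s t) :=
  measurable_snd measurableSet_Ioc

lemma measurableSet_cell (e : G.Dart) (s t : ℝ≥0) :
    MeasurableSet ({e} ×ˢ Ioc s t : Set (G.Dart × ℝ≥0)) :=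
  (measurableSet_singleton e).prod measurableSet_Ioc

lemma clockIntensity_cell {r : ℝ} (hr : 0 ≤ r) (e : G.Dart) (s t : ℝ≥0) :
    clockIntensity G r ({e} ×ˢ Ioc s t) = ENNReal.ofReal (r * (t - s)) := by
  rw [clockIntensity, Measure.smul_apply, Measure.prod_prod, lebesgue_Ioc, Measure.count_singleton,
    one_mul, smul_eq_mul, ENNReal.ofReal_mul hr]

lemma clockIntensity_window [Finite V] {r : ℝ} (hr : 0 ≤ r) (s t : ℝ≥0) :
    clockIntensity G r (window G s t) = ENNReal.ofReal (r * (Nat.card G.Dart * (t - s))) := by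
  have : window G s t = univ ×ˢ Ioc s t := by
    ext x
    simp [mem_window]
  rw [this, clockIntensity, Measure.smul_apply, Measure.prod_prod, lebesgue_Ioc, smul_eq_mul,
    ENNReal.ofReal_mul hr, ENNReal.ofReal_mul (Nat.cast_nonneg _), Measure.count_univ]
  simp [ENat.card_eq_coe_natCard]

lemma clockIntensity_time_zero (r : ℝ) :
    clockIntensity G r (univ ×ˢ ({0} : Set ℝ≥0)) = 0 := by
  rw [clockIntensity, Measure.smul_apply, Measure.prod_prod, lebesgue_singleton]
  simp

end Clocks

/-! ### The conserved quantity -/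

section Algebra

lemma sum_dart_eq_zero {V : Type u} {G : SimpleGraph V} [Fintype G.Dart] (g : G.Dart → ℝ) (h : ∀ e, g e + g e.symm = 0) :
    ∑ e, g e = 0 := by
  have h1 : ∑ e : G.Dart, g e.symm = ∑ e, g e :=
    (SimpleGraph.Dart.symm_involutive (G := G)).bijective.sum_comp g
  have h2 : ∑ e : G.Dart, (g e + g e.symm) = 0 := Finset.sum_eq_zero fun e _ => h e
  rw [Finset.sum_add_distrib, h1] at h2
  linarith

variable {V : Type u} [Fintype V] {G : SimpleGraph V}

lemma sum_copyMap (F : V → V → ℝ) (e : G.Dart) :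
    ∑ x, F (copyMap e x) x = ∑ x, F x x + (F e.fst e.snd - F e.snd e.snd) := by
  classical
  have h : ∀ x, F (copyMap e x) x =
      F x x + if x = e.snd then F e.fst e.snd - F e.snd e.snd else 0 := fun x => by
    by_cases hx : x = e.snd
    · subst hx
      rw [copyMap_snd, if_pos rfl]
      ring
    · rw [copyMap_of_ne e hx, if_neg hx, add_zero]
  simp only [h, Finset.sum_add_distrib, Finset.sum_ite_eq', Finset.mem_univ, if_true]

/-- The combination of the diagonal sum and the total sum of a kernel that the perturbed pair of
voter models preserves on average. -/
def kernelWeight (ε : ℝ) (k : V → V → ℝ) : ℝ :=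
  (1 - ε) * ∑ x, k x x + ε * ∑ x, ∑ y, k x y

/-- Pair each dart `(u, v)` with its reversal. Differences of row sums, of column sums and, for the
joint move, of diagonal entries change sign and cancel. What survives is a multiple of `k u u + k v
v - k u v - k v u`: the two single moves give `-2ε(1 - ε)` through the diagonal sum, the joint move
gives `+2ε(1 - ε)` through the total sum. This dictates the weights in `kernelWeight`. -/
lemma sum_kernelWeight_copyMap [Fintype G.Dart] (ε : ℝ) (k : V → V → ℝ) :
    ∑ e : G.Dart, (ε * (kernelWeight ε (fun x y => k (copyMap e x) y) - kernelWeight ε k) +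
      (1 - ε) * (kernelWeight ε (fun x y => k (copyMap e x) (copyMap e y)) - kernelWeight ε k) +
      ε * (kernelWeight ε (fun x y => k x (copyMap e y)) - kernelWeight ε k)) = 0 := by
  refine sum_dart_eq_zero _ fun e => ?_
  have hrow : ∀ (e : G.Dart) (g : V → ℝ), ∑ x, g (copyMap e x) = ∑ x, g x + (g e.fst - g e.snd) :=
    fun e g => sum_copyMap (fun x _ => g x) e
  have hl : ∀ e : G.Dart, kernelWeight ε (fun x y => k (copyMap e x) y) - kernelWeight ε k =
      (1 - ε) * (k e.fst e.snd - k e.snd e.snd) + ε * (∑ y, k e.fst y - ∑ y, k e.snd y) :=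
    fun e => by
      rw [kernelWeight, kernelWeight, sum_copyMap (fun x y => k x y) e,
        hrow e fun x => ∑ y, k x y]
      ring
  have hr : ∀ e : G.Dart, kernelWeight ε (fun x y => k x (copyMap e y)) - kernelWeight ε k =
      (1 - ε) * (k e.snd e.fst - k e.snd e.snd) + ε * (∑ x, k x e.fst - ∑ x, k x e.snd) :=
    fun e => by
      have h2 : ∀ x, ∑ y, k x (copyMap e y) = ∑ y, k x y + (k x e.fst - k x e.snd) :=
        fun x => hrow e (k x)
      rw [kernelWeight, kernelWeight, sum_copyMap (fun x y => k y x) e]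
      simp only [h2, Finset.sum_add_distrib, Finset.sum_sub_distrib]
      ring
  have hb : ∀ e : G.Dart,
      kernelWeight ε (fun x y => k (copyMap e x) (copyMap e y)) - kernelWeight ε k =
      (1 - ε) * (k e.fst e.fst - k e.snd e.snd) + ε * (∑ y, k e.fst y - ∑ y, k e.snd y +
        (∑ x, k x e.fst - ∑ x, k x e.snd) +
        (k e.fst e.fst - k e.fst e.snd - k e.snd e.fst + k e.snd e.snd)) :=
    fun e => by
      have h2 : ∀ x, ∑ y, k (copyMap e x) (copyMap e y) = ∑ y, k (copyMap e x) y +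
          (k (copyMap e x) e.fst - k (copyMap e x) e.snd) := fun x => hrow e (k (copyMap e x))
      rw [kernelWeight, kernelWeight, hrow e fun x => k x x]
      simp only [h2, Finset.sum_add_distrib, Finset.sum_sub_distrib]
      rw [hrow e fun x => ∑ y, k x y, hrow e fun x => k x e.fst, hrow e fun x => k x e.snd]
      ring
  rw [hl, hr, hb, hl, hr, hb]
  simp only [SimpleGraph.Dart.symm_toProd, Prod.fst_swap, Prod.snd_swap]
  ring

open Classical in
/-- The indicator that the opinion of `x` in the first profile is that of `y` in the second. -/
noncomputable def agreement (s : (V → V) × (V → V)) (x y : V) : ℝ :=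
  if s.1 x = s.2 y then 1 else 0

/-- The conserved quantity of a pair of opinion profiles: a combination of the number of vertices
and of the number of pairs of vertices on which they agree. -/
noncomputable def overlap (ε : ℝ) (s : (V → V) × (V → V)) : ℝ :=
  kernelWeight ε (agreement s)

lemma overlap_id (ε : ℝ) : overlap ε ((id, id) : (V → V) × (V → V)) = Fintype.card V := by
  classical
  have h : ∀ x y : V, agreement (id, id) x y = if x = y then 1 else 0 := fun x y => by
    unfold agreement
    congr
  simp only [overlap, kernelWeight, h, if_true, Finset.sum_const, Finset.sum_ite_eq,
    Finset.mem_univ, Finset.card_univ, nsmul_eq_mul]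
  ring

open Classical in
lemma overlap_const (ε : ℝ) (a b : V) :
    overlap ε ((fun _ => a, fun _ => b) : (V → V) × (V → V)) =
      if a = b then Fintype.card V * (1 + ((Fintype.card V : ℝ) - 1) * ε) else 0 := by
  simp only [overlap, kernelWeight, agreement]
  split_ifs
  · simp only [Finset.sum_const, Finset.card_univ, nsmul_eq_mul]
    ring
  · simp

/-- Averaging over the mark splits the rate `h` of an original tick into `ε h` (deleted) and `(1 -
ε) h` (kept); an additional tick ignores the mark. What remains is `h` times the previous identity.
-/
lemma sum_overlap_tickMap [Fintype G.Dart] (ε : ℝ) (s : (V → V) × (V → V)) (h : ℝ)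
    (ρ : G.Dart ⊕ G.Dart → ℝ) (hl : ∀ e, ρ (.inl e) = h) (hr : ∀ e, ρ (.inr e) = ε * h) :
    ∑ l : G.Dart ⊕ G.Dart, ρ l * (ε * (overlap ε (tickMap (fun _ => true) l s) - overlap ε s) +
      (1 - ε) * (overlap ε (tickMap (fun _ => false) l s) - overlap ε s)) = 0 := by
  have key := sum_kernelWeight_copyMap (G := G) ε (agreement s)
  rw [Fintype.sum_sum_type, ← Finset.sum_add_distrib]
  rw [← mul_zero h, ← key, Finset.mul_sum]
  refine Finset.sum_congr rfl fun e _ => ?_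
  rw [hl, hr]
  have h1 : overlap ε (tickMap (fun _ => true) (.inl e) s) =
    kernelWeight ε fun x y => agreement s (copyMap e x) y := rfl
  have h2 : overlap ε (tickMap (fun _ => false) (.inl e) s) =
    kernelWeight ε fun x y => agreement s (copyMap e x) (copyMap e y) := rfl
  have h3 : ∀ b, overlap ε (tickMap (fun _ => b) (.inr e) s) =
    kernelWeight ε fun x y => agreement s x (copyMap e y) := fun _ => rfl
  rw [h1, h2, h3, h3, overlap]
  ring

end Algebra

/-! ### Measurability of the chain -/

section Measurability

variable {V : Type u} {G : SimpleGraph V} {Ω : Type w} {m : MeasurableSpace Ω}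

lemma measurable_startIndex {c : ℕ → G.Dart ⊕ G.Dart → Ω → ℕ∞} {j : ℕ}
    (hc : ∀ i < j, ∀ l, Measurable (c i l)) (e : G.Dart) :
    Measurable fun ω => startIndex (fun i l => c i l ω) j e := by
  unfold startIndex
  refine Finset.measurable_sum _ fun i hi => ?_
  exact (measurable_of_countable ENat.toNat).comp (hc i (Finset.mem_range.1 hi) (.inl e))

/-- The next state is determined by the cell counts, the marks at the current indices and the
present state, a datum with countably many values since `V` is finite. The σ-algebra is arbitrary so
that it can later be the one of the past. -/
lemma measurableSet_chain_eq [Finite V] {c : ℕ → G.Dart ⊕ G.Dart → Ω → ℕ∞}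
    {del : G.Dart × ℕ → Ω → Bool} {j : ℕ} (hc : ∀ i < j, ∀ l, Measurable (c i l))
    (hdel : ∀ x, Measurable (del x)) (s : (V → V) × (V → V)) :
    MeasurableSet {ω | chain (fun i l => c i l ω) (fun x => del x ω) j = s} := by
  induction j generalizing s with
  | zero =>
    simp only [chain]
    exact MeasurableSet.const _
  | succ j ih =>
    have hc' : ∀ i < j, ∀ l, Measurable (c i l) := fun i hi => hc i (by omega)
    have hd : ∀ e, Measurable fun ω => del (e, startIndex (fun i l => c i l ω) j e) ω := by
      intro e
      refine measurable_to_countable' fun b => ?_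
      have : (fun ω => del (e, startIndex (fun i l => c i l ω) j e) ω) ⁻¹' {b} =
          ⋃ n : ℕ, {ω | startIndex (fun i l => c i l ω) j e = n} ∩ {ω | del (e, n) ω = b} := by
        ext ω
        simp
      rw [this]
      exact MeasurableSet.iUnion fun n =>
        (measurable_startIndex hc' e (measurableSet_singleton n)).inter
          (hdel (e, n) (measurableSet_singleton b))
    have hset : {ω | chain (fun i l => c i l ω) (fun x => del x ω) (j + 1) = s} =
        ⋃ y : {y : (G.Dart ⊕ G.Dart → ℕ∞) × (G.Dart → Bool) × ((V → V) × (V → V)) //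
            cellStep y.1 y.2.1 y.2.2 = s},
          {ω | ∀ l, c j l ω = y.1.1 l} ∩
          ({ω | ∀ e, del (e, startIndex (fun i l => c i l ω) j e) ω = y.1.2.1 e} ∩
            {ω | chain (fun i l => c i l ω) (fun x => del x ω) j = y.1.2.2}) := by
      ext ω
      simp only [mem_ofPred_eq, mem_iUnion, mem_inter_iff, chain]
      constructor
      · intro h
        exact ⟨⟨(_, _, _), h⟩, fun _ => rfl, fun _ => rfl, rfl⟩
      · rintro ⟨⟨⟨a, b, s'⟩, hy⟩, h1, h2, h3⟩
        rw [h3, show (fun l => c j l ω) = a from funext h1,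
          show (fun e => del (e, startIndex (fun i l => c i l ω) j e) ω) = b from funext h2]
        exact hy
    rw [hset]
    refine MeasurableSet.iUnion fun y => ?_
    refine MeasurableSet.inter ?_ (MeasurableSet.inter ?_ (ih hc' _))
    · rw [ofPred_forall]
      exact MeasurableSet.iInter fun l => hc j (by omega) l (measurableSet_singleton _)
    · rw [ofPred_forall]
      exact MeasurableSet.iInter fun e => hd e (measurableSet_singleton _)

lemma measurable_comp_chain [Finite V] {β : Type*} [MeasurableSpace β]
    {c : ℕ → G.Dart ⊕ G.Dart → Ω → ℕ∞}
    {del : G.Dart × ℕ → Ω → Bool} {j : ℕ} (hc : ∀ i < j, ∀ l, Measurable (c i l))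
    (hdel : ∀ x, Measurable (del x)) (F : (V → V) × (V → V) → β) :
    Measurable fun ω => F (chain (fun i l => c i l ω) (fun x => del x ω) j) := by
  let _ : MeasurableSpace ((V → V) × (V → V)) := ⊤
  have h1 : Measurable fun ω => chain (fun i l => c i l ω) (fun x => del x ω) j :=
    measurable_to_countable' fun s => measurableSet_chain_eq hc hdel s
  exact (measurable_from_top (f := F)).comp h1

/-- The chain only looks at the deletion marks below its current tick indices. -/
lemma chain_truncate (c : ℕ → G.Dart ⊕ G.Dart → ℕ∞) (del : G.Dart × ℕ → Bool) (j : ℕ)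
    (κ : G.Dart → ℕ) (hκ : ∀ e, startIndex c j e ≤ κ e) :
    chain c (fun x => if x.2 < κ x.1 then del x else false) j = chain c del j := by
  induction j with
  | zero => rfl
  | succ j ih =>
    have hsucc : ∀ e, startIndex c (j + 1) e = startIndex c j e + (c j (.inl e)).toNat :=
      fun e => Finset.sum_range_succ _ _
    have hle : ∀ e, startIndex c j e ≤ κ e := fun e => by
      have := hκ e
      rw [hsucc] at this
      omega
    rw [chain, chain, ih hle]
    by_cases hex : ∃ l, IsSole (c j) l
    · obtain ⟨l, hl⟩ := hex
      rw [cellStep_of_isSole hl, cellStep_of_isSole hl]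
      rcases l with e | e
      · have h1 := hκ e
        rw [hsucc, hl.1] at h1
        simp only [ENat.toNat_one] at h1
        simp only [tickMap, if_pos (show startIndex c j e < κ e by omega)]
      · rfl
    · rw [cellStep_of_not hex, cellStep_of_not hex]

end Measurability

/-! ### The expected overlap is constant -/

section Conservation

variable {V : Type u} {G : SimpleGraph V} {Ω : Type w} {mΩ : MeasurableSpace Ω}

/-- The σ-algebras generated by the single cell counts and the single deletion marks. -/
abbrev tickSigma (c : ℕ → G.Dart ⊕ G.Dart → Ω → ℕ∞) (del : G.Dart × ℕ → Ω → Bool) :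
    (ℕ × (G.Dart ⊕ G.Dart)) ⊕ (G.Dart × ℕ) → MeasurableSpace Ω :=
  Sum.elim (fun x => MeasurableSpace.comap (c x.1 x.2) inferInstance)
    (fun x => MeasurableSpace.comap (del x) inferInstance)

/-- The cell counts are independent Poisson variables with means `ρ l`, and the deletion marks are
independent of them and i.i.d. Bernoulli(`ε`). -/
structure IsTickFamily (c : ℕ → G.Dart ⊕ G.Dart → Ω → ℕ∞) (del : G.Dart × ℕ → Ω → Bool)
    (ρ : G.Dart ⊕ G.Dart → ℝ) (ε : ℝ) (μ : Measure Ω) : Prop where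
  measurable_count : ∀ j l, Measurable (c j l)
  measurable_del : ∀ x, Measurable (del x)
  indep : iIndep (tickSigma c del) μ
  count_zero : ∀ j l, μ.real {ω | c j l ω = 0} = Real.exp (-ρ l)
  count_one : ∀ j l, μ.real {ω | c j l ω = 1} = Real.exp (-ρ l) * ρ l
  del_true : ∀ x, μ.real {ω | del x ω = true} = ε
  del_false : ∀ x, μ.real {ω | del x ω = false} = 1 - ε

variable {c : ℕ → G.Dart ⊕ G.Dart → Ω → ℕ∞} {del : G.Dart × ℕ → Ω → Bool}
  {ρ : G.Dart ⊕ G.Dart → ℝ} {ε : ℝ} {μ : Measure Ω}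

/-- The dart of a label. -/
def labelDart : G.Dart ⊕ G.Dart → G.Dart := Sum.elim id id

lemma tickMap_congr (d : G.Dart → Bool) (l : G.Dart ⊕ G.Dart) (s : (V → V) × (V → V)) :
    tickMap d l s = tickMap (fun _ => d (labelDart l)) l s := by
  rcases l with e | e <;> rfl

lemma IsTickFamily.tickSigma_le (h : IsTickFamily c del ρ ε μ) (x) : tickSigma c del x ≤ mΩ := by
  rcases x with x | x
  · exact (h.measurable_count _ _).comap_le
  · exact (h.measurable_del _).comap_le

/-- The label `l` contributes `e^{-ρ l} ρ l` and every other label its probability of silence. The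
product of exponentials does not depend on `l`, so a sole tick has label `l` with probability
proportional to `ρ l`. -/
lemma IsTickFamily.measureReal_isSole [Fintype G.Dart] (h : IsTickFamily c del ρ ε μ) (j : ℕ)
    (l : G.Dart ⊕ G.Dart) :
    μ.real {ω | IsSole (fun l => c j l ω) l} = ρ l * ∏ l', Real.exp (-ρ l') := by
  classical
  have hind := h.indep.precomp (g := fun l' => Sum.inl (j, l'))
    fun a b hab => (Prod.mk.inj (Sum.inl_injective hab)).2
  have hset : {ω | IsSole (fun l => c j l ω) l} =
      ⋂ l', {ω | c j l' ω = if l' = l then 1 else 0} := by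
    ext ω
    simp only [IsSole, mem_ofPred_eq, mem_iInter]
    constructor
    · rintro ⟨h1, h2⟩ l'
      split_ifs with hl
      · rw [hl, h1]
      · exact h2 l' hl
    · intro h
      refine ⟨by simpa using h l, fun l' hl => ?_⟩
      simpa [hl] using h l'
  rw [measureReal_def, hset, hind.meas_iInter, ENNReal.toReal_prod]
  · have : ∀ l', (μ {ω | c j l' ω = if l' = l then 1 else 0}).toReal =
        Real.exp (-ρ l') * if l' = l then ρ l else 1 := fun l' => by
      by_cases hl : l' = l
      · simp only [hl, if_true]
        exact h.count_one j l
      · simp only [hl, if_false, mul_one]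
        exact h.count_zero j l'
    rw [Finset.prod_congr rfl fun l' _ => this l', Finset.prod_mul_distrib, Finset.prod_ite_eq',
      if_pos (Finset.mem_univ _), mul_comm]
  · exact fun l' => ⟨{if l' = l then 1 else 0}, measurableSet_singleton _, rfl⟩

/-- The indices of the variables that determine the chain before cell `j` on the event that `κ e`
original ticks of `e` have occurred. -/
def pastIndices (G : SimpleGraph V) (j : ℕ) (κ : G.Dart → ℕ) :
    Set ((ℕ × (G.Dart ⊕ G.Dart)) ⊕ (G.Dart × ℕ)) :=
  {x | Sum.elim (fun y => y.1 < j) (fun y => y.2 < κ y.1) x}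

/-- The marks are read at random indices. On the event that these equal `κ`, the marks from `κ` on
may be replaced by `false` (`chain_truncate`), so the event does not involve the mark to be read
next. -/
lemma measurableSet_past [Finite V] (j : ℕ) (κ : G.Dart → ℕ) (s : (V → V) × (V → V)) :
    MeasurableSet[⨆ x ∈ pastIndices G j κ, tickSigma c del x]
      {ω | (fun e => startIndex (fun i l => c i l ω) j e) = κ ∧
        chain (fun i l => c i l ω) (fun x => del x ω) j = s} := by
  set m := ⨆ x ∈ pastIndices G j κ, tickSigma c del x with hm
  have hc : ∀ i < j, ∀ l, Measurable[m] (c i l) := fun i hi l =>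
    Measurable.mono (comap_measurable _) (le_iSup₂_of_le (Sum.inl (i, l)) hi le_rfl) le_rfl
  have hdel : ∀ x, Measurable[m] (fun ω => if x.2 < κ x.1 then del x ω else false) := fun x => by
    split_ifs with hx
    · exact Measurable.mono (comap_measurable _) (le_iSup₂_of_le (Sum.inr x) hx le_rfl) le_rfl
    · exact measurable_const
  have hset : {ω | (fun e => startIndex (fun i l => c i l ω) j e) = κ ∧
        chain (fun i l => c i l ω) (fun x => del x ω) j = s} =
      {ω | ∀ e, startIndex (fun i l => c i l ω) j e = κ e} ∩
        {ω | chain (fun i l => c i l ω)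
          (fun x => if x.2 < κ x.1 then del x ω else false) j = s} := by
    ext ω
    simp only [mem_ofPred_eq, mem_inter_iff, funext_iff]
    refine and_congr_right fun hκ => ?_
    rw [chain_truncate _ _ _ _ fun e => (hκ e).le]
  rw [hset]
  refine MeasurableSet.inter ?_ (measurableSet_chain_eq (m := m) hc hdel s)
  rw [ofPred_forall]
  exact MeasurableSet.iInter fun e => measurable_startIndex (m := m) hc e (measurableSet_singleton _)

lemma measurableSet_isSole [Finite V] (j : ℕ) (l : G.Dart ⊕ G.Dart) :
    MeasurableSet[⨆ x ∈ {x | ∃ l', x = Sum.inl (j, l')}, tickSigma c del x]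
      {ω | IsSole (fun l => c j l ω) l} := by
  set m := ⨆ x ∈ {x | ∃ l', x = Sum.inl (j, l')}, tickSigma c del x with hm
  have hc : ∀ l, Measurable[m] (c j l) := fun l =>
    Measurable.mono (comap_measurable _) (le_iSup₂_of_le (Sum.inl (j, l)) ⟨l, rfl⟩ le_rfl) le_rfl
  have hset : {ω | IsSole (fun l => c j l ω) l} =
      {ω | c j l ω = 1} ∩ ⋂ l', ⋂ (_ : l' ≠ l), {ω | c j l' ω = 0} := by
    ext ω
    simp [IsSole]
  rw [hset]
  exact (hc l (measurableSet_singleton _)).inter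
    (MeasurableSet.iInter fun l' => MeasurableSet.iInter fun _ => hc l' (measurableSet_singleton _))

lemma measurableSet_del (x : G.Dart × ℕ) (b : Bool) :
    MeasurableSet[⨆ y ∈ ({Sum.inr x} : Set ((ℕ × (G.Dart ⊕ G.Dart)) ⊕ (G.Dart × ℕ))),
      tickSigma c del y] {ω | del x ω = b} := by
  rw [iSup_singleton]
  exact ⟨{b}, measurableSet_singleton _, rfl⟩

/-- The past, the ticks of the current cell and the next deletion mark are independent. -/
lemma IsTickFamily.measureReal_inter [Finite V] [Fintype G.Dart] (h : IsTickFamily c del ρ ε μ)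
    (j : ℕ) (κ : G.Dart → ℕ) (s : (V → V) × (V → V)) (l : G.Dart ⊕ G.Dart) (b : Bool) :
    μ.real ({ω | (fun e => startIndex (fun i l => c i l ω) j e) = κ ∧
        chain (fun i l => c i l ω) (fun x => del x ω) j = s} ∩
      ({ω | IsSole (fun l => c j l ω) l} ∩ {ω | del (labelDart l, κ (labelDart l)) ω = b})) =
    μ.real {ω | (fun e => startIndex (fun i l => c i l ω) j e) = κ ∧
        chain (fun i l => c i l ω) (fun x => del x ω) j = s} *
      ((ρ l * ∏ l', Real.exp (-ρ l')) * if b then ε else 1 - ε) := by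
  set S := pastIndices G j κ
  set T : Set ((ℕ × (G.Dart ⊕ G.Dart)) ⊕ (G.Dart × ℕ)) := {x | ∃ l', x = Sum.inl (j, l')}
  set T' : Set ((ℕ × (G.Dart ⊕ G.Dart)) ⊕ (G.Dart × ℕ)) :=
    {Sum.inr (labelDart l, κ (labelDart l))}
  have hST : Disjoint S (T ∪ T') := by
    refine disjoint_left.2 ?_
    rintro x hx (⟨l', rfl⟩ | rfl)
    · exact lt_irrefl j hx
    · exact lt_irrefl (κ (labelDart l)) hx
  have hTT' : Disjoint T T' := by
    refine disjoint_left.2 ?_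
    rintro x ⟨l', rfl⟩ hx
    simp [T'] at hx
  have hI1 := indep_iSup_of_disjoint h.tickSigma_le h.indep hST
  have hI2 := indep_iSup_of_disjoint h.tickSigma_le h.indep hTT'
  have hA := measurableSet_past (c := c) (del := del) j κ s
  have hU := measurableSet_isSole (c := c) (del := del) j l
  have hD := measurableSet_del (c := c) (del := del) (labelDart l, κ (labelDart l)) b
  have hUD := (Indep_iff _ _ _).1 hI2 _ _ hU hD
  have hA' := (Indep_iff _ _ _).1 hI1 _ _ hA
    (MeasurableSet.inter (biSup_mono (f := tickSigma c del) (fun _ hx => Or.inl hx) _ hU)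
      (biSup_mono (f := tickSigma c del) (fun _ hx => Or.inr hx) _ hD))
  rw [measureReal_def, hA', hUD, ENNReal.toReal_mul, ENNReal.toReal_mul, ← measureReal_def,
    ← measureReal_def, ← measureReal_def, h.measureReal_isSole]
  congr 2
  cases b
  · simpa using h.del_false _
  · simpa using h.del_true _

lemma IsTickFamily.integrable_overlap [Fintype V] [IsFiniteMeasure μ]
    (h : IsTickFamily c del ρ ε μ) (F : (V → V) × (V → V) → ℝ) (j : ℕ) :
    Integrable (fun ω => F (chain (fun i l => c i l ω) (fun x => del x ω) j)) μ := by
  obtain ⟨C, hC⟩ := (Set.finite_range fun s => ‖F s‖).bddAbove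
  exact Integrable.of_bound (measurable_comp_chain (fun i _ l => h.measurable_count i l)
    h.measurable_del F).aestronglyMeasurable C (ae_of_all _ fun ω => hC ⟨_, rfl⟩)

/-- The expected overlap does not change in one step. -/
lemma IsTickFamily.integral_overlap_succ [Fintype V] [IsFiniteMeasure μ]
    (h : IsTickFamily c del ρ ε μ) {r : ℝ} (hl : ∀ e, ρ (.inl e) = r)
    (hr : ∀ e, ρ (.inr e) = ε * r) (j : ℕ) :
    ∫ ω, overlap ε (chain (fun i l => c i l ω) (fun x => del x ω) (j + 1)) ∂μ =
      ∫ ω, overlap ε (chain (fun i l => c i l ω) (fun x => del x ω) j) ∂μ := by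
  classical
  have : Fintype G.Dart := Fintype.ofFinite _
  have hi := h.integrable_overlap (overlap ε)
  rw [← sub_eq_zero, ← integral_sub (hi (j + 1)) (hi j)]
  set f : Ω → ℝ := fun ω => overlap ε (chain (fun i l => c i l ω) (fun x => del x ω) (j + 1)) -
    overlap ε (chain (fun i l => c i l ω) (fun x => del x ω) j) with hf
  -- Split according to the tick indices and the state, which take countably many values. On each
  -- piece the mark that cell `j` may read has a fixed index.
  set A : (G.Dart → ℕ) × ((V → V) × (V → V)) → Set Ω := fun y =>
    {ω | (fun e => startIndex (fun i l => c i l ω) j e) = y.1 ∧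
        chain (fun i l => c i l ω) (fun x => del x ω) j = y.2} with hAdef
  have hAm : ∀ y, MeasurableSet (A y) := fun y =>
    (iSup₂_le fun x _ => h.tickSigma_le x : _ ≤ mΩ) _ (measurableSet_past j y.1 y.2)
  have hdisj : Pairwise (Function.onFun Disjoint A) := fun y y' hy =>
    disjoint_left.2 fun ω h1 h2 => hy (Prod.ext (h1.1.symm.trans h2.1) (h1.2.symm.trans h2.2))
  have huniv : ⋃ y, A y = univ := eq_univ_of_forall fun ω =>
    mem_iUnion.2 ⟨(_, _), rfl, rfl⟩
  have hsum := hasSum_integral_iUnion (μ := μ) (f := f) hAm hdisj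
    ((hi (j + 1)).sub (hi j)).integrableOn
  rw [huniv, Measure.restrict_univ] at hsum
  have hzero : ∀ y, ∫ ω in A y, f ω ∂μ = 0 := by
    intro y
    set E : (G.Dart ⊕ G.Dart) → Bool → Set Ω := fun l b => {ω | IsSole (fun l => c j l ω) l} ∩
      {ω | del (labelDart l, y.1 (labelDart l)) ω = b} with hE
    have hEm : ∀ l b, MeasurableSet (E l b) := fun l b =>
      ((iSup₂_le fun x _ => h.tickSigma_le x : _ ≤ mΩ) _ (measurableSet_isSole j l)).inter
        (h.measurable_del _ (measurableSet_singleton _))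
    -- On `A y` at most one summand is nonzero, the one of the sole tick and its mark; without a
    -- sole tick the state does not move.
    have heq : ∀ ω ∈ A y, f ω = ∑ l, ∑ b, (E l b).indicator
        (fun _ => overlap ε (tickMap (fun _ => b) l y.2) - overlap ε y.2) ω := by
      rintro ω ⟨h1, h2⟩
      simp only [hf, chain, h2]
      by_cases hex : ∃ l, IsSole (fun l => c j l ω) l
      · obtain ⟨l, hl⟩ := hex
        rw [cellStep_of_isSole hl, tickMap_congr, show startIndex (fun i l => c i l ω) j
          (labelDart l) = y.1 (labelDart l) from congrFun h1 _]
        rw [Finset.sum_eq_single l, Finset.sum_eq_single (del (labelDart l, y.1 (labelDart l)) ω),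
          indicator_of_mem]
        · exact ⟨hl, rfl⟩
        · exact fun b _ hb => indicator_of_notMem (fun hm => hb hm.2.symm) _
        · exact fun hn => absurd (Finset.mem_univ _) hn
        · exact fun l' _ hl' => Finset.sum_eq_zero fun b _ =>
            indicator_of_notMem (fun hm => hl' (hl.unique hm.1)) _
        · exact fun hn => absurd (Finset.mem_univ _) hn
      · rw [cellStep_of_not hex, sub_self]
        exact (Finset.sum_eq_zero fun l _ => Finset.sum_eq_zero fun b _ =>
          indicator_of_notMem (fun hm => hex ⟨l, hm.1⟩) _).symm
    rw [setIntegral_congr_fun (hAm y) heq, integral_finsetSum]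
    swap
    · exact fun l _ => integrable_finsetSum _ fun b _ =>
        (integrable_const _).indicator (hEm l b)
    have hterm : ∀ l, ∫ ω in A y, ∑ b, (E l b).indicator
        (fun _ => overlap ε (tickMap (fun _ => b) l y.2) - overlap ε y.2) ω ∂μ =
        μ.real (A y) * (∏ l', Real.exp (-ρ l')) *
        (ρ l * (ε * (overlap ε (tickMap (fun _ => true) l y.2) - overlap ε y.2) +
          (1 - ε) * (overlap ε (tickMap (fun _ => false) l y.2) - overlap ε y.2))) := by
      intro l
      rw [integral_finsetSum _ fun b _ => (integrable_const _).indicator (hEm l b)]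
      have hb : ∀ b, ∫ ω in A y, (E l b).indicator
          (fun _ => overlap ε (tickMap (fun _ => b) l y.2) - overlap ε y.2) ω ∂μ =
          μ.real (A y) * ((ρ l * ∏ l', Real.exp (-ρ l')) * if b then ε else 1 - ε) *
            (overlap ε (tickMap (fun _ => b) l y.2) - overlap ε y.2) := fun b => by
        rw [integral_indicator_const _ (hEm l b), measureReal_restrict_apply (hEm l b), inter_comm,
          h.measureReal_inter, smul_eq_mul]
      rw [Finset.sum_congr rfl fun b _ => hb b, Fintype.sum_bool]
      simp only [if_true, Bool.false_eq_true, if_false]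
      ring
    rw [Finset.sum_congr rfl fun l _ => hterm l, ← Finset.mul_sum,
      sum_overlap_tickMap ε y.2 r ρ hl hr, mul_zero]
  simp only [hzero] at hsum
  exact hsum.unique hasSum_zero

lemma IsTickFamily.integral_overlap [Fintype V] [IsProbabilityMeasure μ]
    (h : IsTickFamily c del ρ ε μ) {r : ℝ} (hl : ∀ e, ρ (.inl e) = r)
    (hr : ∀ e, ρ (.inr e) = ε * r) (j : ℕ) :
    ∫ ω, overlap ε (chain (fun i l => c i l ω) (fun x => del x ω) j) ∂μ = Fintype.card V := by
  induction j with
  | zero => simp [chain, overlap_id]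
  | succ j ih => rw [h.integral_overlap_succ hl hr, ih]

end Conservation

/-! ### Consensus for a single Poisson clock process -/

section Spreading

variable {V : Type u} {G : SimpleGraph V}

lemma gridTime_level_zero (j : ℕ) : gridTime 0 j = j := by simp [gridTime]

lemma gridTime_succ_sub (k j : ℕ) :
    ((gridTime k (j + 1) : ℝ) - gridTime k j) = ((2 : ℝ) ^ k)⁻¹ := by
  simp only [gridTime, NNReal.coe_div, NNReal.coe_natCast, NNReal.coe_pow, NNReal.coe_ofNat]
  push_cast
  ring

/-- Consensus is reached when the ticks of a block of unit time intervals follow a spreading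
list. -/
lemma IsRegular.exists_isConsensus {P : Ticks G} (hP : IsRegular P) {l : List G.Dart} {r : V}
    (hl : ∀ v, flowOf l v = r) (b : ℕ)
    (h : ∀ (i : ℕ) (hi : i < l.length), ∃ t, P ∩ window G (gridTime 0 (b * l.length + i))
      (gridTime 0 (b * l.length + i + 1)) = {(l[i], t)}) :
    ∃ a, IsConsensus P id a := by
  obtain ⟨η, hη⟩ := hP.exists_path (id : V → V)
  have hflow := hη.eq_flowOf ((b * l.length : ℕ) : ℝ≥0) l fun i hi => by
    obtain ⟨t, ht⟩ := h i hi
    refine ⟨t, ?_⟩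
    simpa [gridTime_level_zero] using ht
  refine ⟨η ((b * l.length : ℕ) : ℝ≥0) r, hP.isConsensus_of_const hη
    (s := ((b * l.length : ℕ) : ℝ≥0) + l.length) fun v => ?_⟩
  rw [hflow, Function.comp_apply, hl]

lemma block_injective (s : ℕ) :
    Function.Injective fun x : ℕ × Fin s => x.1 * s + (x.2 : ℕ) := by
  rintro ⟨b, i⟩ ⟨b', i'⟩ h
  have hs : 0 < s := i.pos
  have h1 := congrArg (· / s) h
  have h2 := congrArg (· % s) h
  simp only [Nat.mul_add_mod_self_right, Nat.mod_eq_of_lt i.2, Nat.mod_eq_of_lt i'.2] at h2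
  simp only [Nat.add_comm _ (i : ℕ), Nat.add_comm _ (i' : ℕ), Nat.add_mul_div_right _ _ hs,
    Nat.div_eq_of_lt i.2, Nat.div_eq_of_lt i'.2, zero_add] at h1
  exact Prod.ext h1 (Fin.ext h2)

/-- The cells of the dyadic grids are disjoint. -/
lemma disjoint_cells (k : ℕ) : Pairwise fun x y : ℕ × G.Dart =>
    Disjoint ({x.2} ×ˢ Ioc (gridTime k x.1) (gridTime k (x.1 + 1)) : Set (G.Dart × ℝ≥0))
      ({y.2} ×ˢ Ioc (gridTime k y.1) (gridTime k (y.1 + 1))) := by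
  rintro ⟨i, e⟩ ⟨j, e'⟩ hne
  refine disjoint_left.2 ?_
  rintro ⟨d, t⟩ ⟨h1, h2⟩ ⟨h3, h4⟩
  refine hne (Prod.ext ?_ ((mem_singleton_iff.1 h1).symm.trans (mem_singleton_iff.1 h3)))
  rcases lt_trichotomy i j with h | h | h
  · exact absurd (h2.2.trans (gridTime_mono k h)) (not_le.2 h4.1)
  · exact h
  · exact absurd (h4.2.trans (gridTime_mono k h)) (not_le.2 h2.1)

end Spreading

section SingleClock

variable {V : Type u} {G : SimpleGraph V} {Ω : Type w} {mΩ : MeasurableSpace Ω}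
  {μ : Measure Ω} {N : Ω → Ticks G} {r : ℝ}

lemma IsPoissonPointProcess.iIndepFun_cells {ν : Measure (G.Dart × ℝ≥0)}
    (h : IsPoissonPointProcess ν N μ) (k : ℕ) :
    iIndepFun (fun (x : ℕ × G.Dart) ω =>
      tickCount (N ω) x.2 (gridTime k x.1) (gridTime k (x.1 + 1))) μ :=
  h.iIndepFun_count (fun x : ℕ × G.Dart => {x.2} ×ˢ Ioc (gridTime k x.1) (gridTime k (x.1 + 1)))
    (fun _ => measurableSet_cell _ _ _) (disjoint_cells k)

lemma IsPoissonPointProcess.tickCount_zero (h : IsPoissonPointProcess (clockIntensity G r) N μ)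
    (hr : 0 ≤ r) (k j : ℕ) (e : G.Dart) :
    μ {ω | tickCount (N ω) e (gridTime k j) (gridTime k (j + 1)) = 0} =
      ENNReal.ofReal (Real.exp (-(r * ((2 : ℝ) ^ k)⁻¹))) :=
  h.count_zero (measurableSet_cell _ _ _) (by positivity)
    (by rw [clockIntensity_cell hr, gridTime_succ_sub])

lemma IsPoissonPointProcess.tickCount_one (h : IsPoissonPointProcess (clockIntensity G r) N μ)
    (hr : 0 ≤ r) (k j : ℕ) (e : G.Dart) :
    μ {ω | tickCount (N ω) e (gridTime k j) (gridTime k (j + 1)) = 1} =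
      ENNReal.ofReal (Real.exp (-(r * ((2 : ℝ) ^ k)⁻¹)) * (r * ((2 : ℝ) ^ k)⁻¹)) :=
  h.count_one (measurableSet_cell _ _ _) (by positivity)
    (by rw [clockIntensity_cell hr, gridTime_succ_sub])

variable [IsProbabilityMeasure μ]

lemma IsPoissonPointProcess.ae_no_tick_zero
    (h : IsPoissonPointProcess (clockIntensity G r) N μ) : ∀ᵐ ω ∂μ, ∀ e, (e, 0) ∉ N ω := by
  filter_upwards [h.ae_empty (MeasurableSet.univ.prod (measurableSet_singleton 0))
    (clockIntensity_time_zero r)] with ω hω e he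
  exact eq_empty_iff_forall_notMem.1 hω (e, 0) ⟨he, mem_univ _, rfl⟩

variable [Finite V]

lemma IsPoissonPointProcess.window_ne_zero_le (h : IsPoissonPointProcess (clockIntensity G r) N μ)
    (hr : 0 ≤ r) (k j : ℕ) :
    μ {ω | (N ω ∩ window G (gridTime k j) (gridTime k (j + 1))).encard ≠ 0} ≤
      ENNReal.ofReal (r * Nat.card G.Dart * ((2 : ℝ) ^ k)⁻¹) :=
  h.count_ne_zero_le (measurableSet_window _ _) (by positivity)
    (by rw [clockIntensity_window hr, gridTime_succ_sub, mul_assoc])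

lemma IsPoissonPointProcess.window_gt_one_le (h : IsPoissonPointProcess (clockIntensity G r) N μ)
    (hr : 0 ≤ r) (k j : ℕ) :
    μ {ω | ¬ (N ω ∩ window G (gridTime k j) (gridTime k (j + 1))).encard ≤ 1} ≤
      ENNReal.ofReal ((r * Nat.card G.Dart) ^ 2 * ((2 : ℝ) ^ k)⁻¹ ^ 2) := by
  rw [← mul_pow]
  exact h.count_gt_one_le (measurableSet_window _ _) (by positivity)
    (by rw [clockIntensity_window hr, gridTime_succ_sub, mul_assoc])

lemma IsPoissonPointProcess.ae_isSparse (h : IsPoissonPointProcess (clockIntensity G r) N μ)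
    (hr : 0 ≤ r) : ∀ᵐ ω ∂μ, IsSparse (N ω) ∅ := by
  filter_upwards [ae_eventually_forall_cell fun k j => h.window_gt_one_le hr k j] with ω hω
  filter_upwards [hω] with k hk j hj
  simpa using hk j hj

/-- The pattern asks that in the `i`-th unit cell of a block the dart `l[i]` ticks once and no other
dart ticks. Blocks are independent and each shows the pattern with the same positive probability, so
some block follows the spreading list. -/
lemma IsPoissonPointProcess.ae_exists_isConsensus
    (h : IsPoissonPointProcess (clockIntensity G r) N μ) (hr : 0 < r) (hG : G.Connected) :
    ∀ᵐ ω ∂μ, ∃ a, IsConsensus (N ω) id a := by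
  classical
  have : Fintype G.Dart := Fintype.ofFinite _
  obtain ⟨root⟩ := hG.nonempty
  obtain ⟨l, hl⟩ := exists_spreading_list hG root
  have hind := (h.iIndepFun_cells 0).precomp
    (g := fun x : ℕ × (Fin l.length × G.Dart) => (x.1 * l.length + (x.2.1 : ℕ), x.2.2))
    fun x y hxy => by
      obtain ⟨h1, h2⟩ := Prod.mk.inj hxy
      have h3 := block_injective l.length (a₁ := (x.1, x.2.1)) (a₂ := (y.1, y.2.1)) h1
      obtain ⟨h4, h5⟩ := Prod.mk.inj h3
      exact Prod.ext h4 (Prod.ext h5 h2)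
  have hpat := ae_exists_pattern
    (fun x => h.measurable_count _ (measurableSet_cell _ _ _)) hind
    (fun y => if y.2 = l[y.1] then 1 else 0)
    (fun y => if y.2 = l[y.1] then
      ENNReal.ofReal (Real.exp (-(r * ((2 : ℝ) ^ 0)⁻¹)) * (r * ((2 : ℝ) ^ 0)⁻¹)) else
      ENNReal.ofReal (Real.exp (-(r * ((2 : ℝ) ^ 0)⁻¹))))
    (fun y => by
      split_ifs
      · exact (ENNReal.ofReal_pos.2 (by positivity)).ne'
      · exact (ENNReal.ofReal_pos.2 (by positivity)).ne')
    (fun b y => by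
      split_ifs
      · exact h.tickCount_one hr.le 0 _ _
      · exact h.tickCount_zero hr.le 0 _ _)
  filter_upwards [hpat, h.ae_isSparse hr.le] with ω ⟨b, hb⟩ hsparse
  refine (hsparse.isRegular.mono subset_union_left).exists_isConsensus hl b fun i hi => ?_
  refine window_eq_singleton ?_ fun e' he' => ?_
  · simpa [tickCount] using hb (⟨i, hi⟩, l[i])
  · simpa [tickCount, he'] using hb (⟨i, hi⟩, e')

end SingleClock

/-! ### Sparseness and consensus for the perturbed clocks -/

namespace ClockNoiseModel

variable {V : Type u} {G : SimpleGraph V} {p ε : ℝ} (M : ClockNoiseModel.{u, w} G p ε)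

lemma sigma_le (i : Fin 4) : (![sigmaOf M.opinion, sigmaOfConfig M.clock, sigmaOf M.del,
    sigmaOfConfig M.extra] : Fin 4 → MeasurableSpace M.Ω) i ≤ M.mΩ := by
  fin_cases i
  · exact M.opinion_law.sigmaOf_le
  · exact M.clock_law.sigmaOfConfig_le
  · exact M.del_law.sigmaOf_le
  · exact M.extra_law.sigmaOfConfig_le

lemma indep_clock_extra : Indep (sigmaOfConfig M.clock) (sigmaOfConfig M.extra) M.μ :=
  M.indep.indep (i := 1) (j := 3) (by decide)

lemma indep_ticks_del :
    Indep (sigmaOfConfig M.clock ⊔ sigmaOfConfig M.extra) (sigmaOf M.del) M.μ := by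
  refine indep_of_indep_of_le (indep_iSup_of_disjoint M.sigma_le M.indep
    (S := {1, 3}) (T := {2}) (by simp)) ?_ ?_
  · exact sup_le (le_iSup₂_of_le (1 : Fin 4) (by simp) le_rfl)
      (le_iSup₂_of_le (3 : Fin 4) (by simp) le_rfl)
  · exact le_iSup₂_of_le (2 : Fin 4) (by simp) le_rfl

lemma indep_noise_opinion : Indep (sigmaOfConfig M.clock ⊔ sigmaOfConfig M.extra ⊔ sigmaOf M.del)
    (sigmaOf M.opinion) M.μ := by
  refine indep_of_indep_of_le (indep_iSup_of_disjoint M.sigma_le M.indep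
    (S := {1, 2, 3}) (T := {0}) (by simp)) ?_ ?_
  · exact sup_le (sup_le (le_iSup₂_of_le (1 : Fin 4) (by simp) le_rfl)
      (le_iSup₂_of_le (3 : Fin 4) (by simp) le_rfl)) (le_iSup₂_of_le (2 : Fin 4) (by simp) le_rfl)
  · exact le_iSup₂_of_le (0 : Fin 4) (by simp) le_rfl

/-- The cell counts of the original and of the additional ticks. -/
noncomputable def count (k j : ℕ) (l : G.Dart ⊕ G.Dart) (ω : M.Ω) : ℕ∞ :=
  cellCount (M.clock ω) (M.extra ω) k j l

lemma comap_count_le (k j : ℕ) (l : G.Dart ⊕ G.Dart) :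
    MeasurableSpace.comap (M.count k j l) inferInstance ≤
      sigmaOfConfig M.clock ⊔ sigmaOfConfig M.extra := by
  rcases l with e | e
  · exact (comap_count_le_sigmaOfConfig (measurableSet_cell _ _ _)).trans le_sup_left
  · exact (comap_count_le_sigmaOfConfig (measurableSet_cell _ _ _)).trans le_sup_right

lemma iIndep_count (k : ℕ) : iIndep (fun x : ℕ × (G.Dart ⊕ G.Dart) =>
    MeasurableSpace.comap (M.count k x.1 x.2) inferInstance) M.μ := by
  have h := iIndep_sumElim ((iIndepFun_iff_iIndep _ _ _).1 (M.clock_law.iIndepFun_cells k))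
    ((iIndepFun_iff_iIndep _ _ _).1 (M.extra_law.iIndepFun_cells k)) M.indep_clock_extra
    (fun x => comap_count_le_sigmaOfConfig (measurableSet_cell _ _ _))
    (fun x => comap_count_le_sigmaOfConfig (measurableSet_cell _ _ _))
  have h2 := h.precomp (Equiv.prodSumDistrib ℕ G.Dart G.Dart).injective
  convert h2 using 1
  funext x
  rcases x with ⟨j, e | e⟩ <;> rfl

lemma isTickFamily (hε : ε ∈ Icc (0 : ℝ) 1) (k : ℕ) :
    IsTickFamily (M.count k) M.del
      (Sum.elim (fun _ => ((2 : ℝ) ^ k)⁻¹) (fun _ => ε * ((2 : ℝ) ^ k)⁻¹)) ε M.μ where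
  measurable_count j l := by
    rcases l with e | e
    · exact M.clock_law.measurable_count _ (measurableSet_cell _ _ _)
    · exact M.extra_law.measurable_count _ (measurableSet_cell _ _ _)
  measurable_del := M.del_law.measurable
  indep := iIndep_sumElim (M.iIndep_count k) ((iIndepFun_iff_iIndep _ _ _).1 M.del_law.indep)
    M.indep_ticks_del (fun x => M.comap_count_le k x.1 x.2) (fun x => comap_le_sigmaOf _ x)
  count_zero j l := by
    rcases l with e | e
    · have := M.clock_law.tickCount_zero zero_le_one k j e
      rw [one_mul] at this
      exact (congrArg ENNReal.toReal this).trans (ENNReal.toReal_ofReal (by positivity))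
    · exact (congrArg ENNReal.toReal (M.extra_law.tickCount_zero hε.1 k j e)).trans
        (ENNReal.toReal_ofReal (by positivity))
  count_one j l := by
    rcases l with e | e
    · have := M.clock_law.tickCount_one zero_le_one k j e
      rw [one_mul] at this
      exact (congrArg ENNReal.toReal this).trans (ENNReal.toReal_ofReal (by positivity))
    · have := hε.1
      exact (congrArg ENNReal.toReal (M.extra_law.tickCount_one hε.1 k j e)).trans
        (ENNReal.toReal_ofReal (by positivity))
  del_true := M.del_law.measureReal_true hε.1
  del_false := M.del_law.measureReal_false hε.1

lemma noisyClock_subset (ω : M.Ω) : M.noisyClock ω ⊆ M.clock ω ∪ M.extra ω :=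
  union_subset_union_left _ fun _ hx => hx.1

variable [Finite V]

/-- A crowded cell holds two original ticks, two additional ticks, or one of each. The last case
also has probability `O(4⁻ᵏ)`, since the two processes are independent. -/
lemma ae_isSparse (hε : ε ∈ Icc (0 : ℝ) 1) : ∀ᵐ ω ∂M.μ, IsSparse (M.clock ω) (M.extra ω) := by
  have hε0 := hε.1
  have hboth : ∀ k j, M.μ
      ({ω | (M.clock ω ∩ window G (gridTime k j) (gridTime k (j + 1))).encard ≠ 0} ∩
        {ω | (M.extra ω ∩ window G (gridTime k j) (gridTime k (j + 1))).encard ≠ 0}) ≤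
      ENNReal.ofReal ((1 * Nat.card G.Dart) * (ε * Nat.card G.Dart) * ((2 : ℝ) ^ k)⁻¹ ^ 2) := by
    intro k j
    have hm : ∀ N : M.Ω → Ticks G, MeasurableSet[sigmaOfConfig N]
        {ω | (N ω ∩ window G (gridTime k j) (gridTime k (j + 1))).encard ≠ 0} := fun N =>
      comap_count_le_sigmaOfConfig (measurableSet_window _ _) _
        ⟨{0}ᶜ, (measurableSet_singleton _).compl, rfl⟩
    rw [(Indep_iff _ _ _).1 M.indep_clock_extra _ _ (hm _) (hm _)]
    refine (mul_le_mul' (M.clock_law.window_ne_zero_le zero_le_one k j)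
      (M.extra_law.window_ne_zero_le hε.1 k j)).trans (le_of_eq ?_)
    rw [← ENNReal.ofReal_mul (by positivity)]
    congr 1
    ring
  filter_upwards [ae_eventually_forall_cell fun k j => M.clock_law.window_gt_one_le zero_le_one k j,
    ae_eventually_forall_cell fun k j => M.extra_law.window_gt_one_le hε.1 k j,
    ae_eventually_forall_cell hboth] with ω h1 h2 h3
  filter_upwards [h1, h2, h3] with k h1 h2 h3 j hj
  have h1 := not_not.1 (h1 j hj)
  have h2 := not_not.1 (h2 j hj)
  by_cases h0 : (M.clock ω ∩ window G (gridTime k j) (gridTime k (j + 1))).encard = 0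
  · rw [h0, zero_add]
    exact h2
  · have h0' : (M.extra ω ∩ window G (gridTime k j) (gridTime k (j + 1))).encard = 0 := by
      by_contra hne
      exact h3 j hj ⟨h0, hne⟩
    rw [h0', add_zero]
    exact h1

lemma ae_isRegular (hε : ε ∈ Icc (0 : ℝ) 1) :
    ∀ᵐ ω ∂M.μ, IsRegular (M.clock ω) ∧ IsRegular (M.noisyClock ω) := by
  filter_upwards [M.ae_isSparse hε] with ω hω
  exact ⟨hω.isRegular.mono subset_union_left, hω.isRegular.mono (M.noisyClock_subset ω)⟩

lemma ae_exists_isConsensus (hG : G.Connected) : ∀ᵐ ω ∂M.μ, ∃ a, IsConsensus (M.clock ω) id a :=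
  M.clock_law.ae_exists_isConsensus zero_lt_one hG

/-- The spreading list is required of the additional ticks, in a block without original ticks.
Deletions then play no role and the law of `P^ε` is not needed. This uses `ε > 0`; for `ε = 0` both
clocks agree almost surely. -/
lemma ae_exists_isConsensus_noisy_of_pos (hε : ε ∈ Icc (0 : ℝ) 1) (hpos : 0 < ε)
    (hG : G.Connected) : ∀ᵐ ω ∂M.μ, ∃ a, IsConsensus (M.noisyClock ω) id a := by
  classical
  have : Fintype G.Dart := Fintype.ofFinite _
  obtain ⟨root⟩ := hG.nonempty
  obtain ⟨l, hl⟩ := exists_spreading_list hG root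
  have hind := ((iIndepFun_iff_iIndep _ _ _).2 (M.iIndep_count 0)).precomp
    (g := fun x : ℕ × (Fin l.length × (G.Dart ⊕ G.Dart)) =>
      (x.1 * l.length + (x.2.1 : ℕ), x.2.2))
    fun x y hxy => by
      obtain ⟨h1, h2⟩ := Prod.mk.inj hxy
      have h3 := block_injective l.length (a₁ := (x.1, x.2.1)) (a₂ := (y.1, y.2.1)) h1
      obtain ⟨h4, h5⟩ := Prod.mk.inj h3
      exact Prod.ext h4 (Prod.ext h5 h2)
  have hpat := ae_exists_pattern (fun x => (M.isTickFamily hε 0).measurable_count _ _) hind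
    (fun y => if y.2 = .inr l[y.1] then 1 else 0)
    (fun y => Sum.elim (fun _ => ENNReal.ofReal (Real.exp (-(1 * ((2 : ℝ) ^ 0)⁻¹))))
      (fun e => if e = l[y.1] then
        ENNReal.ofReal (Real.exp (-(ε * ((2 : ℝ) ^ 0)⁻¹)) * (ε * ((2 : ℝ) ^ 0)⁻¹)) else
        ENNReal.ofReal (Real.exp (-(ε * ((2 : ℝ) ^ 0)⁻¹)))) y.2)
    (fun y => by
      rcases y with ⟨i, e | e⟩
      · exact (ENNReal.ofReal_pos.2 (by positivity)).ne'
      · simp only [Sum.elim_inr]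
        split_ifs
        · exact (ENNReal.ofReal_pos.2 (by positivity)).ne'
        · exact (ENNReal.ofReal_pos.2 (by positivity)).ne')
    (fun b y => by
      rcases y with ⟨i, e | e⟩
      · simp only [reduceCtorEq, if_false, Sum.elim_inl]
        exact M.clock_law.tickCount_zero zero_le_one 0 _ _
      · simp only [Sum.inr.injEq, Sum.elim_inr]
        split_ifs
        · exact M.extra_law.tickCount_one hpos.le 0 _ _
        · exact M.extra_law.tickCount_zero hpos.le 0 _ _)
  filter_upwards [hpat, M.ae_isRegular hε] with ω ⟨b, hb⟩ hreg
  refine hreg.2.exists_isConsensus hl b fun i hi => ?_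
  obtain ⟨t, ht⟩ := window_eq_singleton (P := M.extra ω) (e := l[i])
    (s := gridTime 0 (b * l.length + i)) (t := gridTime 0 (b * l.length + i + 1))
    (by simpa [count, cellCount] using hb (⟨i, hi⟩, .inr l[i]))
    (fun e' he' => by simpa [count, cellCount, he'] using hb (⟨i, hi⟩, .inr e'))
  have hempty := window_eq_empty (P := M.clock ω)
    (s := gridTime 0 (b * l.length + i)) (t := gridTime 0 (b * l.length + i + 1))
    (fun e' => by simpa [count, cellCount] using hb (⟨i, hi⟩, .inl e'))
  refine ⟨t, ?_⟩
  rw [noisyClock, union_inter_distrib_right, ht, subset_empty_iff.1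
    ((inter_subset_inter_left _ fun _ hx => hx.1).trans hempty.subset), empty_union]

lemma ae_noisyClock_eq_of_zero {p : ℝ} (M : ClockNoiseModel.{u, w} G p 0) :
    ∀ᵐ ω ∂M.μ, M.noisyClock ω = M.clock ω := by
  have hdel : ∀ᵐ ω ∂M.μ, ∀ x, M.del x ω = false := by
    rw [ae_all_iff]
    intro x
    have := M.del_law.law x
    rw [ENNReal.ofReal_zero] at this
    filter_upwards [measure_eq_zero_iff_ae_notMem.1 this] with ω hω
    simpa using hω
  have hextra := M.extra_law.ae_empty MeasurableSet.univ (by simp [clockIntensity])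
  filter_upwards [hdel, hextra] with ω h1 h2
  rw [inter_univ] at h2
  rw [noisyClock, h2, union_empty]
  ext x
  simp [thinning, h1]

lemma ae_exists_isConsensus_noisy (hε : ε ∈ Icc (0 : ℝ) 1) (hG : G.Connected) :
    ∀ᵐ ω ∂M.μ, ∃ a, IsConsensus (M.noisyClock ω) id a := by
  rcases hε.1.eq_or_lt with rfl | hpos
  · filter_upwards [M.ae_noisyClock_eq_of_zero, M.ae_exists_isConsensus hG] with ω h1 h2
    rwa [h1]
  · exact M.ae_exists_isConsensus_noisy_of_pos hε hpos hG

end ClockNoiseModel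

/-! ### Passage to the limit, and ancestors read off from the ticks -/

section Limits

variable {Ω : Type w} {mΩ : MeasurableSpace Ω} {μ : Measure Ω}

lemma tendsto_integral_of_eventually_eq [IsFiniteMeasure μ] {F : ℕ → Ω → ℝ} {f : Ω → ℝ} (C : ℝ)
    (hF : ∀ k, Measurable (F k)) (hC : ∀ k ω, ‖F k ω‖ ≤ C)
    (h : ∀ᵐ ω ∂μ, ∀ᶠ k in atTop, F k ω = f ω) :
    Tendsto (fun k => ∫ ω, F k ω ∂μ) atTop (𝓝 (∫ ω, f ω ∂μ)) :=
  tendsto_integral_of_dominated_convergence (fun _ => C) (fun k => (hF k).aestronglyMeasurable)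
    (integrable_const C) (fun k => ae_of_all _ (hC k))
    (h.mono fun _ hω => tendsto_const_nhds.congr' (hω.mono fun _ hk => hk.symm))

lemma aestronglyMeasurable_of_eventually_eq {F : ℕ → Ω → ℝ} {f : Ω → ℝ}
    (hF : ∀ k, Measurable (F k)) (h : ∀ᵐ ω ∂μ, ∀ᶠ k in atTop, F k ω = f ω) :
    AEStronglyMeasurable f μ :=
  aestronglyMeasurable_of_tendsto_ae atTop (fun k => (hF k).aestronglyMeasurable)
    (h.mono fun _ hω => tendsto_const_nhds.congr' (hω.mono fun _ hk => hk.symm))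

/-- The probability of an event chosen by an independent variable. -/
lemma measureReal_mem_of_indep [IsFiniteMeasure μ] {ι : Type*} [Fintype ι] {Y : Ω → ι}
    {m₁ m₂ : MeasurableSpace Ω} (hind : Indep m₁ m₂ μ) (h₁ : m₁ ≤ mΩ) (h₂ : m₂ ≤ mΩ)
    (hY : ∀ y, MeasurableSet[m₁] {ω | Y ω = y}) {E : ι → Set Ω}
    (hE : ∀ y, MeasurableSet[m₂] (E y)) :
    μ.real {ω | ω ∈ E (Y ω)} = ∑ y, μ.real {ω | Y ω = y} * μ.real (E y) := by
  have hset : {ω | ω ∈ E (Y ω)} = ⋃ y ∈ (Finset.univ : Finset ι), {ω | Y ω = y} ∩ E y := by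
    ext ω
    simp
  rw [hset, measureReal_biUnion_finset]
  · refine Finset.sum_congr rfl fun y _ => ?_
    rw [measureReal_def, (Indep_iff _ _ _).1 hind _ _ (hY y) (hE y), ENNReal.toReal_mul]
    rfl
  · exact fun y _ y' _ hne => disjoint_left.2 fun ω h h' => hne (h.1.symm.trans h'.1)
  · exact fun y _ => (h₁ _ (hY y)).inter (h₂ _ (hE y))

lemma sum_measureReal_fiber [IsProbabilityMeasure μ] {ι : Type*} [Fintype ι] {Y : Ω → ι}
    (hY : ∀ y, MeasurableSet {ω | Y ω = y}) : ∑ y, μ.real {ω | Y ω = y} = 1 := by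
  have h := measureReal_mem_of_indep (μ := μ) (indep_bot_right mΩ) le_rfl bot_le hY
    (E := fun _ => univ) fun _ => MeasurableSet.univ
  simpa using h.symm

end Limits

section SingleClock

variable {V : Type u} {G : SimpleGraph V} {Ω : Type w} {mΩ : MeasurableSpace Ω}
  {μ : Measure Ω} {N : Ω → Ticks G} {r : ℝ}

lemma measurable_tickCount (k j : ℕ) (e : G.Dart) : Measurable[sigmaOfConfig N] fun ω =>
    tickCount (N ω) e (gridTime k j) (gridTime k (j + 1)) :=
  measurable_iff_comap_le.2 (comap_count_le_sigmaOfConfig (measurableSet_cell _ _ _))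

/-- On a regular configuration of ticks with consensus, the discretized trajectories reach it. -/
lemma eventually_chain_eq {P Q : Ticks G} {del : G.Dart × ℕ → Bool}
    (hsparse : IsSparse P Q) (hP0 : ∀ e, (e, 0) ∉ P) {a b : V} (ha : IsConsensus P id a)
    (hb : IsConsensus (thinning P del ∪ Q) id b) :
    ∀ᶠ k in atTop, chain (cellCount P Q k) del (k * 2 ^ k) = (fun _ => a, fun _ => b) := by
  obtain ⟨η, hη, hη'⟩ := ha
  obtain ⟨ξ, hξ, hξ'⟩ := hb
  filter_upwards [hsparse, tendsto_natCast_atTop_atTop.eventually hη',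
    tendsto_natCast_atTop_atTop.eventually hξ'] with k hk h1 h2
  rw [chain_eq (hsparse.isRegular.mono subset_union_left) hP0 hk hη hξ le_rfl, gridTime_mul]
  exact Prod.ext (funext h1) (funext h2)

/-- The discretized ancestor of the consensus. -/
noncomputable def ancestorApprox (N : Ω → Ticks G) (v₀ : V) (k : ℕ) (ω : Ω) : V :=
  (chain (cellCount (N ω) ∅ k) (fun _ => false) (k * 2 ^ k)).1 v₀

lemma measurableSet_ancestorApprox [Finite V] (v₀ : V) (k : ℕ) (a : V) :
    MeasurableSet[sigmaOfConfig N] {ω | ancestorApprox N v₀ k ω = a} := by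
  have hc : ∀ i < k * 2 ^ k, ∀ l, Measurable[sigmaOfConfig N]
      fun ω => cellCount (N ω) ∅ k i l := by
    rintro i - (e | e)
    · exact measurable_tickCount k i e
    · exact measurable_const
  let _ : MeasurableSpace V := ⊤
  exact measurable_comp_chain (m := sigmaOfConfig N) (del := fun _ _ => false) hc
    (fun _ => measurable_const) (fun s => s.1 v₀) (MeasurableSpace.measurableSet_top (s := {a}))

lemma IsPoissonPointProcess.ae_eventually_ancestorApprox [Finite V] [IsProbabilityMeasure μ]
    (h : IsPoissonPointProcess (clockIntensity G r) N μ) (hr : 0 < r) (hG : G.Connected) (v₀ : V) :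
    ∀ᵐ ω ∂μ, ∃ a, IsRegular (N ω) ∧ IsConsensus (N ω) id a ∧
      ∀ᶠ k in atTop, ancestorApprox N v₀ k ω = a := by
  filter_upwards [h.ae_isSparse hr.le, h.ae_no_tick_zero, h.ae_exists_isConsensus hr hG]
    with ω h1 h2 ⟨a, ha⟩
  refine ⟨a, h1.isRegular.mono subset_union_left, ha, ?_⟩
  have hthin : thinning (N ω) (fun _ => false) ∪ ∅ = N ω := by
    ext x
    simp [thinning]
  filter_upwards [eventually_chain_eq h1 h2 ha (b := a) (del := fun _ => false) (by rwa [hthin])]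
    with k hk
  rw [ancestorApprox, hk]

end SingleClock

/-! ### Stability under resampling of the initial opinions -/

namespace InitialNoiseModel

variable {V : Type u} {G : SimpleGraph V} {p ε : ℝ} (M : InitialNoiseModel.{u, w} G p ε)

lemma ae_existsUnique [Finite V] (hG : G.Connected) : ∀ᵐ ω ∂M.μ,
    (∃! x, IsConsensus (M.clock ω) (M.init ω) x) ∧
      (∃! x, IsConsensus (M.clock ω) (M.noisyInit ω) x) := by
  have := hG.nonempty
  filter_upwards [M.clock_law.ae_eventually_ancestorApprox zero_lt_one hG (Classical.arbitrary V)]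
    with ω ⟨a, hreg, ha, _⟩
  exact ⟨hreg.existsUnique_consensus ha _, hreg.existsUnique_consensus ha _⟩

lemma indep_clock_resample : Indep (sigmaOfConfig M.clock) (sigmaOf M.resample) M.μ :=
  M.indep.indep (i := 3) (j := 1) (by decide)

/-- The outcomes differ only if the ancestor is resampled. The discretized ancestor is a function of
the clocks, hence independent of the marks, so it is resampled with probability exactly `ε`. -/
lemma measure_f_ne_fNoisy_le [Fintype V] (hε : ε ∈ Icc (0 : ℝ) 1) (hG : G.Connected) :
    M.μ {ω | M.f ω ≠ M.fNoisy ω} ≤ ENNReal.ofReal ε := by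
  obtain ⟨v₀⟩ := hG.nonempty
  have : Nonempty V := ⟨v₀⟩
  set B : ℕ → Set M.Ω := fun k => {ω | M.resample (ancestorApprox M.clock v₀ k ω) ω = true} with hB
  have hBm : ∀ k, M.μ (B k) = ENNReal.ofReal ε := by
    intro k
    have hY := measurableSet_ancestorApprox (N := M.clock) v₀ k
    have hreal := measureReal_mem_of_indep (μ := M.μ) M.indep_clock_resample
      M.clock_law.sigmaOfConfig_le M.resample_law.sigmaOf_le hY
      (E := fun a => {ω | M.resample a ω = true})
      fun a => comap_le_sigmaOf M.resample a _ ⟨{true}, measurableSet_singleton _, rfl⟩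
    simp only [M.resample_law.measureReal_true hε.1, ← Finset.sum_mul] at hreal
    rw [sum_measureReal_fiber fun a => M.clock_law.sigmaOfConfig_le _ (hY a), one_mul] at hreal
    exact (ofReal_measureReal (s := B k)).symm.trans (congrArg ENNReal.ofReal hreal)
  -- The discretized ancestor is eventually the true one, so disagreement forces all but finitely
  -- many of the events `B k`. Only an inclusion is used, so the event of disagreement need not be
  -- measurable.
  have hsub : {ω | M.f ω ≠ M.fNoisy ω} ≤ᵐ[M.μ] ⋃ n : ℕ, ⋂ k ≥ n, B k := by
    filter_upwards [M.clock_law.ae_eventually_ancestorApprox zero_lt_one hG v₀]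
      with ω ⟨a, hreg, ha, hev⟩ hne
    replace hne : M.f ω ≠ M.fNoisy ω := hne
    rw [f, fNoisy, hreg.consensus_eq ha, hreg.consensus_eq ha] at hne
    have hres : M.resample a ω = true := by
      by_contra hcon
      exact hne (by simp [noisyInit, init, hcon])
    obtain ⟨n, hn⟩ := eventually_atTop.1 hev
    refine mem_iUnion.2 ⟨n, mem_iInter₂.2 fun k hk => ?_⟩
    simp only [hB, mem_ofPred_eq, hn k hk, hres]
  refine (measure_mono_ae hsub).trans ?_
  have hmono : Monotone fun n : ℕ => ⋂ k ≥ n, B k := fun n n' hnn' =>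
    biInter_mono (fun k (hk : k ≥ n') => hnn'.trans hk) fun _ _ => subset_rfl
  rw [hmono.measure_iUnion]
  exact iSup_le fun n => (measure_mono (biInter_subset_of_mem (le_refl n))).trans (hBm n).le

end InitialNoiseModel

/-! ### Probability of a common ancestor and the covariance -/

namespace ClockNoiseModel

variable {V : Type u} {G : SimpleGraph V} {p ε : ℝ} (M : ClockNoiseModel.{u, w} G p ε)

/-- The discretized pair of trajectories, for finer and finer grids and longer and longer times. -/
noncomputable def pairApprox (k : ℕ) (ω : M.Ω) : (V → V) × (V → V) :=
  chain (fun j l => M.count k j l ω) (fun x => M.del x ω) (k * 2 ^ k)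

lemma ae_eventually_pairApprox [Finite V] (hε : ε ∈ Icc (0 : ℝ) 1) (hG : G.Connected) :
    ∀ᵐ ω ∂M.μ, ∃ a b, IsRegular (M.clock ω) ∧ IsRegular (M.noisyClock ω) ∧
      IsConsensus (M.clock ω) id a ∧ IsConsensus (M.noisyClock ω) id b ∧
      ∀ᶠ k in atTop, M.pairApprox k ω = (fun _ => a, fun _ => b) := by
  filter_upwards [M.ae_isSparse hε, M.ae_isRegular hε, M.clock_law.ae_no_tick_zero,
    M.ae_exists_isConsensus hG, M.ae_exists_isConsensus_noisy hε hG]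
    with ω h1 h2 h3 ⟨a, ha⟩ ⟨b, hb⟩
  exact ⟨a, b, h2.1, h2.2, ha, hb, eventually_chain_eq h1 h3 ha hb⟩

lemma ae_existsUnique [Finite V] (hε : ε ∈ Icc (0 : ℝ) 1) (hG : G.Connected) : ∀ᵐ ω ∂M.μ,
    (∃! x, IsConsensus (M.clock ω) (M.init ω) x) ∧
      (∃! x, IsConsensus (M.noisyClock ω) (M.init ω) x) := by
  have := hG.nonempty
  filter_upwards [M.ae_eventually_pairApprox hε hG] with ω ⟨a, b, h1, h2, ha, hb, _⟩
  exact ⟨h1.existsUnique_consensus ha _, h2.existsUnique_consensus hb _⟩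

lemma measurable_pairApprox [Finite V] {β : Type*} [MeasurableSpace β]
    (F : (V → V) × (V → V) → β) (k : ℕ) :
    Measurable[sigmaOfConfig M.clock ⊔ sigmaOfConfig M.extra ⊔ sigmaOf M.del]
      fun ω => F (M.pairApprox k ω) :=
  measurable_comp_chain
    (m := sigmaOfConfig M.clock ⊔ sigmaOfConfig M.extra ⊔ sigmaOf M.del)
    (fun i _ l => measurable_iff_comap_le.2 ((M.comap_count_le k i l).trans le_sup_left))
    (fun x => measurable_iff_comap_le.2 ((comap_le_sigmaOf M.del x).trans le_sup_right)) F

lemma noiseSigma_le :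
    sigmaOfConfig M.clock ⊔ sigmaOfConfig M.extra ⊔ sigmaOf M.del ≤ M.mΩ :=
  sup_le (sup_le M.clock_law.sigmaOfConfig_le M.extra_law.sigmaOfConfig_le) M.del_law.sigmaOf_le

/-- The discretized ancestors of the two consensus opinions. -/
noncomputable def ancestors (v₀ : V) (k : ℕ) (ω : M.Ω) : V × V :=
  ((M.pairApprox k ω).1 v₀, (M.pairApprox k ω).2 v₀)

lemma measurableSet_ancestors [Finite V] (v₀ : V) (k : ℕ) (y : V × V) :
    MeasurableSet[sigmaOfConfig M.clock ⊔ sigmaOfConfig M.extra ⊔ sigmaOf M.del]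
      {ω | M.ancestors v₀ k ω = y} := by
  let _ : MeasurableSpace (V × V) := ⊤
  exact M.measurable_pairApprox (fun s => (s.1 v₀, s.2 v₀)) k
    (MeasurableSpace.measurableSet_top (s := {y}))

/-- The discretized consensus opinions. -/
noncomputable def fApprox (v₀ : V) (k : ℕ) (ω : M.Ω) : ℝ × ℝ :=
  (opinionValue (M.opinion (M.ancestors v₀ k ω).1 ω),
    opinionValue (M.opinion (M.ancestors v₀ k ω).2 ω))

lemma ae_eventually_fApprox [Finite V] (hε : ε ∈ Icc (0 : ℝ) 1) (hG : G.Connected) (v₀ : V) :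
    ∀ᵐ ω ∂M.μ, ∀ᶠ k in atTop, M.fApprox v₀ k ω = (M.f ω, M.fNoisy ω) := by
  have : Nonempty V := ⟨v₀⟩
  filter_upwards [M.ae_eventually_pairApprox hε hG] with ω ⟨a, b, h1, h2, ha, hb, hev⟩
  filter_upwards [hev] with k hk
  rw [f, fNoisy, h1.consensus_eq ha, h2.consensus_eq hb, fApprox, ancestors, hk]
  rfl

lemma measurableSet_opinion (a b : V) : MeasurableSet[sigmaOf M.opinion]
    {ω | M.opinion a ω = true ∧ M.opinion b ω = true} :=
  MeasurableSet.inter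
    (comap_le_sigmaOf M.opinion a _ ⟨{true}, measurableSet_singleton _, rfl⟩)
    (comap_le_sigmaOf M.opinion b _ ⟨{true}, measurableSet_singleton _, rfl⟩)

-- The value is `p` or `p ^ 2`, written so that `p - p ^ 2` multiplies the indicator of a common
-- ancestor.
open Classical in
lemma measureReal_opinion_and (hp : 0 ≤ p) (a b : V) :
    M.μ.real {ω | M.opinion a ω = true ∧ M.opinion b ω = true} =
      p ^ 2 + (p - p ^ 2) * if a = b then 1 else 0 := by
  by_cases hab : a = b
  · subst hab
    simp only [and_self, if_true]
    rw [M.opinion_law.measureReal_true hp]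
    ring
  · have h := (M.opinion_law.indep.indepFun hab).measure_inter_preimage_eq_mul {true} {true}
      (measurableSet_singleton _) (measurableSet_singleton _)
    have h2 := congrArg ENNReal.toReal h
    rw [ENNReal.toReal_mul] at h2
    rw [if_neg hab, mul_zero, add_zero, sq]
    exact h2.trans (congrArg₂ (· * ·) (M.opinion_law.measureReal_true hp a)
      (M.opinion_law.measureReal_true hp b))

variable [Fintype V]

lemma measurable_opinion_comp {Y : M.Ω → V} (hY : ∀ a, MeasurableSet {ω | Y ω = a}) :
    Measurable fun ω => opinionValue (M.opinion (Y ω) ω) := by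
  have h : Measurable fun ω => M.opinion (Y ω) ω := by
    refine measurable_to_countable' fun b => ?_
    have : (fun ω => M.opinion (Y ω) ω) ⁻¹' {b} =
        ⋃ a, {ω | Y ω = a} ∩ {ω | M.opinion a ω = b} := by
      ext ω
      simp
    rw [this]
    exact MeasurableSet.iUnion fun a =>
      (hY a).inter (M.opinion_law.measurable a (measurableSet_singleton b))
  exact (measurable_of_countable opinionValue).comp h

open Classical in
/-- The joint expectation of the opinions of two random vertices chosen by the noise. -/
lemma integral_opinion_mul (hp : 0 ≤ p) {Y : M.Ω → V × V}
    (hY : ∀ y, MeasurableSet[sigmaOfConfig M.clock ⊔ sigmaOfConfig M.extra ⊔ sigmaOf M.del]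
      {ω | Y ω = y}) :
    ∫ ω, opinionValue (M.opinion (Y ω).1 ω) * opinionValue (M.opinion (Y ω).2 ω) ∂M.μ =
      p ^ 2 + (p - p ^ 2) * ∫ ω, (if (Y ω).1 = (Y ω).2 then 1 else 0 : ℝ) ∂M.μ := by
  have hle := M.noiseSigma_le
  have h1 := measureReal_mem_of_indep (μ := M.μ) M.indep_noise_opinion hle
    M.opinion_law.sigmaOf_le hY
    (E := fun y => {ω | M.opinion y.1 ω = true ∧ M.opinion y.2 ω = true})
    fun y => M.measurableSet_opinion y.1 y.2
  -- Applied to events that do not depend on the outcome, the same formula expands the probability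
  -- that the two vertices coincide.
  have h2 := measureReal_mem_of_indep (μ := M.μ) M.indep_noise_opinion hle
    M.opinion_law.sigmaOf_le hY (E := fun y => {_ω | y.1 = y.2}) fun y => MeasurableSet.const _
  have hm1 : MeasurableSet {ω | ω ∈ {ω' | M.opinion (Y ω).1 ω' = true ∧
      M.opinion (Y ω).2 ω' = true}} := by
    have : {ω | ω ∈ {ω' | M.opinion (Y ω).1 ω' = true ∧ M.opinion (Y ω).2 ω' = true}} =
        ⋃ y : V × V, {ω | Y ω = y} ∩
          {ω | M.opinion y.1 ω = true ∧ M.opinion y.2 ω = true} := by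
      ext ω
      simp
    rw [this]
    exact MeasurableSet.iUnion fun y =>
      (hle _ (hY y)).inter (M.opinion_law.sigmaOf_le _ (M.measurableSet_opinion _ _))
  have hm2 : MeasurableSet {ω | ω ∈ {_ω' : M.Ω | (Y ω).1 = (Y ω).2}} := by
    have : {ω | ω ∈ {_ω' : M.Ω | (Y ω).1 = (Y ω).2}} =
        ⋃ y : {y : V × V // y.1 = y.2}, {ω | Y ω = y} := by
      ext ω
      simp
    rw [this]
    exact MeasurableSet.iUnion fun y => hle _ (hY y)
  have e1 : (fun ω => opinionValue (M.opinion (Y ω).1 ω) * opinionValue (M.opinion (Y ω).2 ω)) =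
      indicator {ω | ω ∈ {ω' | M.opinion (Y ω).1 ω' = true ∧ M.opinion (Y ω).2 ω' = true}} 1 := by
    funext ω
    simp only [indicator, mem_ofPred_eq, opinionValue, Pi.one_apply]
    by_cases ha : M.opinion (Y ω).1 ω = true <;> by_cases hb : M.opinion (Y ω).2 ω = true <;>
      simp [ha, hb]
  have e2 : (fun ω => (if (Y ω).1 = (Y ω).2 then 1 else 0 : ℝ)) =
      indicator {ω | ω ∈ {_ω' : M.Ω | (Y ω).1 = (Y ω).2}} 1 := by
    funext ω
    simp [indicator]
  rw [e1, e2, integral_indicator_one hm1, integral_indicator_one hm2, h1, h2]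
  have hreal : ∀ y : V × V, M.μ.real {_ω : M.Ω | y.1 = y.2} = if y.1 = y.2 then 1 else 0 := by
    intro y
    by_cases hy : y.1 = y.2 <;> simp [hy]
  simp only [M.measureReal_opinion_and hp, hreal, mul_add, Finset.sum_add_distrib,
    ← Finset.sum_mul]
  rw [sum_measureReal_fiber fun y => hle _ (hY y), one_mul, Finset.mul_sum]
  congr 1
  exact Finset.sum_congr rfl fun y _ => by ring

end ClockNoiseModel

lemma norm_opinionValue_le (b : Bool) : ‖opinionValue b‖ ≤ 1 := by
  cases b <;> simp [opinionValue]

lemma opinionValue_mul_self (b : Bool) : opinionValue b * opinionValue b = opinionValue b := by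
  cases b <;> simp [opinionValue]

namespace ClockNoiseModel

variable {V : Type u} {G : SimpleGraph V} {p ε : ℝ} (M : ClockNoiseModel.{u, w} G p ε) [Fintype V]

lemma measurableSet_ancestors_comp {β : Type*} (v₀ : V) (k : ℕ) (g : V × V → β) (b : β) :
    MeasurableSet[sigmaOfConfig M.clock ⊔ sigmaOfConfig M.extra ⊔ sigmaOf M.del]
      {ω | g (M.ancestors v₀ k ω) = b} := by
  have : {ω | g (M.ancestors v₀ k ω) = b} =
      ⋃ y : {y // g y = b}, {ω | M.ancestors v₀ k ω = y} := by
    ext ω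
    simp
  rw [this]
  exact MeasurableSet.iUnion fun y => M.measurableSet_ancestors v₀ k y

lemma measurable_fApprox_fst (v₀ : V) (k : ℕ) : Measurable fun ω => (M.fApprox v₀ k ω).1 :=
  M.measurable_opinion_comp fun a =>
    M.noiseSigma_le _ (M.measurableSet_ancestors_comp v₀ k Prod.fst a)

lemma measurable_fApprox_snd (v₀ : V) (k : ℕ) : Measurable fun ω => (M.fApprox v₀ k ω).2 :=
  M.measurable_opinion_comp fun a =>
    M.noiseSigma_le _ (M.measurableSet_ancestors_comp v₀ k Prod.snd a)

/-- Take both vertices equal to `Y`: a `0`-`1` opinion is its own square, and `p ^ 2 + (p - p ^ 2) =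
p`. -/
lemma integral_opinion (hp : 0 ≤ p) {Y : M.Ω → V}
    (hY : ∀ y, MeasurableSet[sigmaOfConfig M.clock ⊔ sigmaOfConfig M.extra ⊔ sigmaOf M.del]
      {ω | Y ω = y}) :
    ∫ ω, opinionValue (M.opinion (Y ω) ω) ∂M.μ = p := by
  have h := M.integral_opinion_mul hp (Y := fun ω => (Y ω, Y ω)) fun y => by
    have : {ω | (Y ω, Y ω) = y} = {ω | Y ω = y.1} ∩ {ω | Y ω = y.2} := by
      ext ω
      simp [Prod.ext_iff]
    rw [this]
    exact (hY y.1).inter (hY y.2)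
  simpa [opinionValue_mul_self] using h

lemma integral_f (hp : 0 ≤ p) (hε : ε ∈ Icc (0 : ℝ) 1) (hG : G.Connected) :
    ∫ ω, M.f ω ∂M.μ = p := by
  obtain ⟨v₀⟩ := hG.nonempty
  refine tendsto_nhds_unique (tendsto_integral_of_eventually_eq 1 (M.measurable_fApprox_fst v₀)
    (fun k ω => norm_opinionValue_le _) ((M.ae_eventually_fApprox hε hG v₀).mono fun ω h =>
      h.mono fun k hk => congrArg Prod.fst hk)) (tendsto_const_nhds.congr fun k => ?_)
  exact (M.integral_opinion hp (M.measurableSet_ancestors_comp v₀ k Prod.fst)).symm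

lemma integral_fNoisy (hp : 0 ≤ p) (hε : ε ∈ Icc (0 : ℝ) 1) (hG : G.Connected) :
    ∫ ω, M.fNoisy ω ∂M.μ = p := by
  obtain ⟨v₀⟩ := hG.nonempty
  refine tendsto_nhds_unique (tendsto_integral_of_eventually_eq 1 (M.measurable_fApprox_snd v₀)
    (fun k ω => norm_opinionValue_le _) ((M.ae_eventually_fApprox hε hG v₀).mono fun ω h =>
      h.mono fun k hk => congrArg Prod.snd hk)) (tendsto_const_nhds.congr fun k => ?_)
  exact (M.integral_opinion hp (M.measurableSet_ancestors_comp v₀ k Prod.snd)).symm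

lemma one_add_mul_pos (hε : ε ∈ Icc (0 : ℝ) 1) {n : ℕ} (hn : 1 ≤ n) :
    0 < 1 + ((n : ℝ) - 1) * ε := by
  have h1 : (1 : ℝ) ≤ n := by exact_mod_cast hn
  have := mul_nonneg (sub_nonneg.2 h1) hε.1
  linarith

open Classical in
/-- The discretized ancestors coincide with asymptotic probability `1 / (1 + (n - 1) ε)`. -/
lemma tendsto_integral_ancestors_eq (hε : ε ∈ Icc (0 : ℝ) 1) (hG : G.Connected) (v₀ : V) :
    Tendsto (fun k => ∫ ω, (if (M.ancestors v₀ k ω).1 = (M.ancestors v₀ k ω).2 then 1 else 0 : ℝ)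
      ∂M.μ) atTop (𝓝 (1 / (1 + ((Fintype.card V : ℝ) - 1) * ε))) := by
  have hpos : 0 < Fintype.card V := Fintype.card_pos_iff.2 ⟨v₀⟩
  have hD := one_add_mul_pos hε hpos
  have hn : (Fintype.card V : ℝ) ≠ 0 := by exact_mod_cast hpos.ne'
  set D := 1 + ((Fintype.card V : ℝ) - 1) * ε with hDdef
  set K : (V → V) × (V → V) → ℝ := fun s => if s.1 v₀ = s.2 v₀ then 1 else 0 with hK
  -- `H` vanishes on pairs of constant profiles, where the overlap is `n D` or `0`. So its integral
  -- tends to `0`, while that of the overlap is always `n`; this determines the limit of the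
  -- integral of `K`.
  set H : (V → V) × (V → V) → ℝ := fun s => overlap ε s - Fintype.card V * D * K s with hH
  obtain ⟨C, hC⟩ := (Set.finite_range fun s => ‖H s‖).bddAbove
  have hlim := tendsto_integral_of_eventually_eq (μ := M.μ) (f := fun _ => 0)
    (F := fun k ω => H (M.pairApprox k ω)) C
    (fun k => (M.measurable_pairApprox H k).mono M.noiseSigma_le le_rfl)
    (fun k ω => hC ⟨_, rfl⟩) ((M.ae_eventually_pairApprox hε hG).mono (by
      rintro ω ⟨a, b, -, -, -, -, hev⟩
      filter_upwards [hev] with k hk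
      simp only [hH, hK, hk, overlap_const, ← hDdef]
      split_ifs <;> simp))
  have hint : ∀ F : (V → V) × (V → V) → ℝ, ∀ k, Integrable (fun ω => F (M.pairApprox k ω)) M.μ :=
    fun F k => (M.isTickFamily hε k).integrable_overlap F _
  have heq : ∀ k, ∫ ω, H (M.pairApprox k ω) ∂M.μ =
      Fintype.card V - Fintype.card V * D * ∫ ω, K (M.pairApprox k ω) ∂M.μ := fun k => by
    simp only [hH]
    rw [integral_sub (hint _ k) ((hint K k).const_mul _), integral_const_mul]
    congr 1
    exact (M.isTickFamily hε k).integral_overlap (fun _ => rfl) (fun _ => rfl) _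
  simp only [heq, integral_zero] at hlim
  have h2 := (tendsto_const_nhds (x := (Fintype.card V : ℝ))).sub hlim |>.div_const
    (Fintype.card V * D)
  rw [sub_zero] at h2
  have h3 : (Fintype.card V : ℝ) / (Fintype.card V * D) = 1 / D := by
    field_simp
  rw [h3] at h2
  refine h2.congr fun k => ?_
  rw [sub_sub_cancel, mul_div_cancel_left₀ _ (mul_ne_zero hn hD.ne')]
  rfl

lemma integral_f_mul_fNoisy (hp : 0 ≤ p) (hε : ε ∈ Icc (0 : ℝ) 1) (hG : G.Connected) :
    ∫ ω, M.f ω * M.fNoisy ω ∂M.μ =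
      p ^ 2 + (p - p ^ 2) / (1 + ((Fintype.card V : ℝ) - 1) * ε) := by
  classical
  obtain ⟨v₀⟩ := hG.nonempty
  refine tendsto_nhds_unique (tendsto_integral_of_eventually_eq 1
    (fun k => (M.measurable_fApprox_fst v₀ k).mul (M.measurable_fApprox_snd v₀ k))
    (fun k ω => ?_) ((M.ae_eventually_fApprox hε hG v₀).mono fun ω h =>
      h.mono fun k hk => ?_)) ?_
  · exact (norm_mul_le _ _).trans (mul_le_one₀ (norm_opinionValue_le _) (norm_nonneg _)
      (norm_opinionValue_le _))
  · simp only [Pi.mul_apply, hk]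
  · have h := ((M.tendsto_integral_ancestors_eq hε hG v₀).const_mul (p - p ^ 2)).const_add (p ^ 2)
    rw [mul_one_div] at h
    exact h.congr fun k =>
      (M.integral_opinion_mul hp (M.measurableSet_ancestors v₀ k)).symm

/-- `f` and `fNoisy` are bounded and almost everywhere limits of measurable approximations, hence
square integrable. Both means are `p`. -/
lemma covariance_f_fNoisy (hp : 0 ≤ p) (hε : ε ∈ Icc (0 : ℝ) 1) (hG : G.Connected) :
    cov[M.f, M.fNoisy; M.μ] = (p - p ^ 2) / (1 + ((Fintype.card V : ℝ) - 1) * ε) := by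
  obtain ⟨v₀⟩ := hG.nonempty
  have hev := M.ae_eventually_fApprox hε hG v₀
  have hf : MemLp M.f 2 M.μ := MemLp.of_bound
    (aestronglyMeasurable_of_eventually_eq (M.measurable_fApprox_fst v₀) (hev.mono fun ω h =>
      h.mono fun k hk => congrArg Prod.fst hk)) 1 (ae_of_all _ fun ω => norm_opinionValue_le _)
  have hf' : MemLp M.fNoisy 2 M.μ := MemLp.of_bound
    (aestronglyMeasurable_of_eventually_eq (M.measurable_fApprox_snd v₀) (hev.mono fun ω h =>
      h.mono fun k hk => congrArg Prod.snd hk)) 1 (ae_of_all _ fun ω => norm_opinionValue_le _)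
  rw [covariance_eq_sub hf hf', M.integral_f hp hε hG, M.integral_fNoisy hp hε hG]
  have := M.integral_f_mul_fNoisy hp hε hG
  simp only [Pi.mul_apply, this]
  ring

end ClockNoiseModel

/-! ### Asymptotics of the covariance formula -/

section Asymptotics

variable {q : ℝ} {ε c : ℕ → ℝ}

/-- The denominator `1 + (n - 1) ε` is at most `1 + n ε`, and at least `n ε` because `ε ≤ 1`. -/
lemma div_one_add_le (hq : 0 < q) (hε : ∀ n, ε n ∈ Icc (0 : ℝ) 1)
    (hc : ∀ n, 1 ≤ n → c n = q / (1 + ((n : ℝ) - 1) * ε n)) {n : ℕ} (hn : 1 ≤ n) :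
    q / (1 + n * ε n) ≤ c n ∧ c n ≤ q / max 1 (n * ε n) := by
  have h1 : (1 : ℝ) ≤ n := by exact_mod_cast hn
  obtain ⟨h0, h2⟩ := hε n
  have hD := ClockNoiseModel.one_add_mul_pos (hε n) hn
  have h3 := mul_nonneg (sub_nonneg.2 h1) h0
  rw [hc n hn]
  constructor
  · exact div_le_div_of_nonneg_left hq.le hD (by nlinarith)
  · exact div_le_div_of_nonneg_left hq.le (lt_max_of_lt_left one_pos)
      (max_le (by linarith) (by nlinarith))

lemma tendsto_cov_iff (hq : 0 < q) (hε : ∀ n, ε n ∈ Icc (0 : ℝ) 1)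
    (hc : ∀ n, 1 ≤ n → c n = q / (1 + ((n : ℝ) - 1) * ε n)) :
    Tendsto c atTop (𝓝 0) ↔ Tendsto (fun n : ℕ => (n : ℝ) * ε n) atTop atTop := by
  constructor
  · intro h
    -- This positive quantity lies below `c n` and so tends to `0` from above; inverting it shows `n
    -- * ε n → ∞`.
    have h1 : Tendsto (fun n : ℕ => q / (1 + n * ε n)) atTop (𝓝[>] 0) := by
      refine tendsto_nhdsWithin_iff.2 ⟨?_, Eventually.of_forall fun n => ?_⟩
      · refine squeeze_zero' (Eventually.of_forall fun n => ?_)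
          ((eventually_ge_atTop 1).mono fun n hn => (div_one_add_le hq hε hc hn).1) h
        have := (hε n).1
        positivity
      · have := (hε n).1
        exact mem_Ioi.2 (by positivity)
    have h2 := (h1.inv_tendsto_nhdsGT_zero.const_mul_atTop hq).atTop_add
      (tendsto_const_nhds (x := (-1 : ℝ)))
    refine h2.congr fun n => ?_
    have := (hε n).1
    have h3 : (1 + n * ε n) ≠ 0 := by positivity
    simp only [Pi.inv_apply]
    field_simp
    ring
  · intro h
    refine squeeze_zero' ((eventually_ge_atTop 1).mono fun n hn => ?_)
      ((eventually_ge_atTop 1).mono fun n hn => (div_one_add_le hq hε hc hn).2) ?_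
    · have := (hε n).1
      exact le_trans (by positivity) (div_one_add_le hq hε hc hn).1
    · exact (tendsto_atTop_mono (fun n => le_max_right _ _) h).const_div_atTop q

lemma cov_lower_bound (hq : 0 < q) (hε : ∀ n, ε n ∈ Icc (0 : ℝ) 1)
    (hc : ∀ n, 1 ≤ n → c n = q / (1 + ((n : ℝ) - 1) * ε n))
    (hb : BddAbove (range fun n : ℕ => (n : ℝ) * ε n)) :
    0 < limsup c atTop ∧ ∃ a : ℝ, 0 < a ∧ ∀ n, 1 ≤ n → a ≤ c n := by
  obtain ⟨B, hB⟩ := hb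
  have hB' : ∀ n : ℕ, n * ε n ≤ B := fun n => hB ⟨n, rfl⟩
  -- The bound at `n = 0`.
  have hB0 : 0 ≤ B := by simpa using hB' 0
  have hlow : ∀ n, 1 ≤ n → q / (1 + B) ≤ c n := fun n hn => by
    refine le_trans ?_ (div_one_add_le hq hε hc hn).1
    have := (hε n).1
    exact div_le_div_of_nonneg_left hq.le (by positivity) (by linarith [hB' n])
  have hpos : 0 < q / (1 + B) := by positivity
  refine ⟨hpos.trans_le ?_, _, hpos, hlow⟩
  refine le_limsup_of_frequently_le ((eventually_ge_atTop 1).mono hlow).frequently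
    -- The comparison with a real `limsup` needs an upper bound on `c`, and `q` is one.
    ⟨q, eventually_map.2 ((eventually_ge_atTop 1).mono fun n hn => ?_)⟩
  exact (div_one_add_le hq hε hc hn).2.trans (div_le_self hq.le (le_max_left _ _))

end Asymptotics

end Voter

/-! ### The theorem -/

theorem theorem1 {V : ℕ → Type*} [∀ n, Fintype (V n)] (hV : ∀ n, Fintype.card (V n) = n)
    (G : ∀ n, SimpleGraph (V n)) (hG : ∀ n, 1 ≤ n → (G n).Connected)
    (p : ℝ) (hp : p ∈ Ioo (0 : ℝ) 1) :
    -- noise stability with respect to the initial condition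
    (∀ M : ∀ (n : ℕ) (ε : Icc (0 : ℝ) 1), Voter.InitialNoiseModel (G n) p ε,
      (∀ n, 1 ≤ n → ∀ ε, ∀ᵐ ω ∂(M n ε).μ,
        (∃! x, Voter.IsConsensus ((M n ε).clock ω) ((M n ε).init ω) x) ∧
        (∃! x, Voter.IsConsensus ((M n ε).clock ω) ((M n ε).noisyInit ω) x)) ∧
      (∀ n, 1 ≤ n → ∀ ε,
        (M n ε).μ {ω | (M n ε).f ω ≠ (M n ε).fNoisy ω} ≤ ENNReal.ofReal ε) ∧
      Tendsto (fun ε => ⨆ (n : ℕ) (_ : 1 ≤ n), (M n ε).μ {ω | (M n ε).f ω ≠ (M n ε).fNoisy ω})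
        (𝓝 0) (𝓝 0)) ∧
    -- noise sensitivity with respect to the clock ticks
    (∀ ε : ℝ, 0 < ε → ε ≤ 1 → ∀ M : ∀ n : ℕ, Voter.ClockNoiseModel (G n) p ε,
      Tendsto (fun n => ∫ ω, (M n).f ω * (M n).fNoisy ω ∂(M n).μ - (∫ ω, (M n).f ω ∂(M n).μ) ^ 2)
        atTop (𝓝 0)) ∧
    -- the covariance when the noise level depends on `n`
    (∀ ε : ℕ → ℝ, (∀ n, ε n ∈ Icc (0 : ℝ) 1) →
      ∀ M : ∀ n : ℕ, Voter.ClockNoiseModel (G n) p (ε n),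
      (∀ n, 1 ≤ n → ∀ᵐ ω ∂(M n).μ,
        (∃! x, Voter.IsConsensus ((M n).clock ω) ((M n).init ω) x) ∧
        (∃! x, Voter.IsConsensus ((M n).noisyClock ω) ((M n).init ω) x)) ∧
      (∀ n, 1 ≤ n →
        cov[(M n).f, (M n).fNoisy; (M n).μ] = (p - p ^ 2) / (1 + ((n : ℝ) - 1) * ε n)) ∧
      (Tendsto (fun n => cov[(M n).f, (M n).fNoisy; (M n).μ]) atTop (𝓝 0) ↔
        Tendsto (fun n : ℕ => (n : ℝ) * ε n) atTop atTop) ∧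
      (Tendsto (fun n : ℕ => (n : ℝ) * ε n) atTop atTop →
        limsup (fun n => cov[(M n).f, (M n).fNoisy; (M n).μ]) atTop = 0) ∧
      (BddAbove (range fun n : ℕ => (n : ℝ) * ε n) →
        0 < limsup (fun n => cov[(M n).f, (M n).fNoisy; (M n).μ]) atTop ∧
        ∃ c : ℝ, 0 < c ∧ ∀ n, 1 ≤ n → c ≤ cov[(M n).f, (M n).fNoisy; (M n).μ])) := by
  have hq : 0 < p - p ^ 2 := by
    have := mul_pos hp.1 (sub_pos.2 hp.2)
    nlinarith
  refine ⟨fun M => ?_, fun ε h0 h1 M => ?_, fun ε hε M => ?_⟩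
  · have hle : ∀ n, 1 ≤ n → ∀ ε,
        (M n ε).μ {ω | (M n ε).f ω ≠ (M n ε).fNoisy ω} ≤ ENNReal.ofReal ε :=
      fun n hn ε => (M n ε).measure_f_ne_fNoisy_le ε.2 (hG n hn)
    refine ⟨fun n hn ε => (M n ε).ae_existsUnique (hG n hn), hle, ?_⟩
    have hlim : Tendsto (fun ε : Icc (0 : ℝ) 1 => ENNReal.ofReal ε) (𝓝 0) (𝓝 0) := by
      have := (ENNReal.continuous_ofReal.comp continuous_subtype_val).tendsto (0 : Icc (0 : ℝ) 1)
      simpa [Function.comp_def] using this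
    exact tendsto_of_tendsto_of_tendsto_of_le_of_le tendsto_const_nhds hlim (fun _ => zero_le)
      fun ε => iSup₂_le fun n hn => hle n hn ε
  · have hε : ∀ _ : ℕ, ε ∈ Icc (0 : ℝ) 1 := fun _ => ⟨h0.le, h1⟩
    -- Sensitivity is the case of a constant noise level, for which `n * ε → ∞`.
    refine (Voter.tendsto_cov_iff hq hε fun n hn => ?_).2
      (tendsto_natCast_atTop_atTop.atTop_mul_const h0)
    rw [(M n).integral_f_mul_fNoisy hp.1.le (hε n) (hG n hn),
      (M n).integral_f hp.1.le (hε n) (hG n hn), hV n]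
    ring
  · have hcov : ∀ n, 1 ≤ n →
        cov[(M n).f, (M n).fNoisy; (M n).μ] = (p - p ^ 2) / (1 + ((n : ℝ) - 1) * ε n) :=
      fun n hn => by rw [(M n).covariance_f_fNoisy hp.1.le (hε n) (hG n hn), hV n]
    have hiff := Voter.tendsto_cov_iff hq hε hcov
    exact ⟨fun n hn => (M n).ae_existsUnique (hε n) (hG n hn), hcov, hiff,
      fun h => (hiff.2 h).limsup_eq, Voter.cov_lower_bound hq hε hcov⟩
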